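/- Let $\mathbb K$ be a field of characteristic zero, $n\ge 1$, and let $d_0,\dots,d_n$ be positive integers. Let $\mathbf D=\mathbb K\langle x_0,\dots,x_n,\partial_0,\dots,\partial_n\rangle$ be the Weyl algebra, graded by $\deg x_i=d_i$, $\deg\partial_i=-d_i$, let $E=\sum_i d_i x_i\partial_i$ be the Euler field, and let $J=(x_0,\dots,x_n)\subset\mathbb K[x_0,\dots,x_n]$. For a $\mathbf D$-module $M$ and $\mu\in\mathbb K$ put $M^\mu=\{m\in M: Em=\mu m\}$. For $\lambda\in\mathbb K$, a $\mathbf D$-module $M$ is called $\lambda$-Euler if $M=\bigoplus_{k\in\mathbb Z}M^{\lambda+k}$; it is then graded by $M_k=M^{\lambda+k}$. It is called torsion if every $m\in M$ satisfies $J^km=0$ for some $k$. The category $\mathcal D^\lambda_{[\mathbb P(V)]}\text{-Qcoh}$ of $\lambda$-twisted D-modules on the weighted projective stack $[\mathbb P(V)]$ with weights $d_0,\dots,d_n$ is the quotient of the category of $\lambda$-Euler $\mathbf D$-modules by the subcategory of torsion modules. Let $\omega$ be the right adjoint of the quotient functor, and let $$\Gamma_\lambda:\ \mathcal D^\lambda_{[\mathbb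 P(V)]}\text{-Qcoh}\longrightarrow \mathbf D_0/\mathbf D_0(E-\lambda)\text{-Mod},\qquad \Gamma_\lambda(\mathcal M)=\omega(\mathcal M)_0=\omega(\mathcal M)^\lambda$$ be the global sections functor. Let $\operatorname{Ker}\Gamma_\lambda$ be the full subcategory of those $\mathcal M$ with $\Gamma_\lambda(\mathcal M)=0$, and let $\mathcal A=\sum_i\mathbb Z_{\ge 0}\,d_i$. (1) If $\gcd(d_0,\dots,d_n)=1$ and $\lambda\in(\mathbb K\setminus\mathbb Z)\cup\mathcal A$, then $\operatorname{Ker}\Gamma_\lambda$ is the zero category: every $\mathcal M$ with $\Gamma_\lambda(\mathcal M)=0$ is a zero object, so every nonzero $\lambda$-twisted D-module has nonzero global sections. (2) If $\gcd(d_0,\dots,d_n)>1$, then for every $\lambda\in\mathbb K$ the category $\operatorname{Ker}\Gamma_\lambda$ contains a nonzero object. -/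

import Mathlib

open CategoryTheory

set_option linter.unusedSectionVars false

universe u

noncomputable section

namespace WeightedDMod

/-! ## The Weyl algebra -/

/-- The defining relations of the Weyl algebra: the generators are `xᵢ = Sum.inl i` and
`∂ᵢ = Sum.inr i`. -/
inductive WeylRel (K : Type u) [Field K] (ι : Type) [DecidableEq ι] :
    FreeAlgebra K (ι ⊕ ι) → FreeAlgebra K (ι ⊕ ι) → Prop
  | x_x (i j : ι) : WeylRel K ι
      (FreeAlgebra.ι K (Sum.inl i) * FreeAlgebra.ι K (Sum.inl j))
      (FreeAlgebra.ι K (Sum.inl j) * FreeAlgebra.ι K (Sum.inl i))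
  | del_del (i j : ι) : WeylRel K ι
      (FreeAlgebra.ι K (Sum.inr i) * FreeAlgebra.ι K (Sum.inr j))
      (FreeAlgebra.ι K (Sum.inr j) * FreeAlgebra.ι K (Sum.inr i))
  | del_x (i j : ι) : WeylRel K ι
      (FreeAlgebra.ι K (Sum.inr i) * FreeAlgebra.ι K (Sum.inl j))
      (FreeAlgebra.ι K (Sum.inl j) * FreeAlgebra.ι K (Sum.inr i) + if i = j then 1 else 0)

/-- The Weyl algebra `K⟨xᵢ, ∂ᵢ⟩` on the index set `ι`. -/
def Weyl (K : Type u) [Field K] (ι : Type) [DecidableEq ι] : Type u :=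
  RingQuot (WeylRel K ι)

section Weyl

variable (K : Type u) [Field K] (ι : Type) [DecidableEq ι]

instance : Ring (Weyl K ι) := inferInstanceAs (Ring (RingQuot (WeylRel K ι)))

instance : Algebra K (Weyl K ι) := inferInstanceAs (Algebra K (RingQuot (WeylRel K ι)))

variable {ι}

/-- The generators of the Weyl algebra: `gen (Sum.inl i) = xᵢ`, `gen (Sum.inr i) = ∂ᵢ`. -/
def gen (s : ι ⊕ ι) : Weyl K ι :=
  RingQuot.mkAlgHom K (WeylRel K ι) (FreeAlgebra.ι K s)

/-- The coordinate `xᵢ`. -/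
def x (i : ι) : Weyl K ι := gen K (Sum.inl i)

/-- The derivation `∂ᵢ`. -/
def del (i : ι) : Weyl K ι := gen K (Sum.inr i)

lemma x_mul_x (i j : ι) : x K i * x K j = x K j * x K i := by
  have h := RingQuot.mkAlgHom_rel K (WeylRel.x_x (K := K) i j)
  rw [map_mul, map_mul] at h
  exact h

lemma del_mul_del (i j : ι) : del K i * del K j = del K j * del K i := by
  have h := RingQuot.mkAlgHom_rel K (WeylRel.del_del (K := K) i j)
  rw [map_mul, map_mul] at h
  exact h

lemma del_mul_x (i j : ι) :
    del K i * x K j = x K j * del K i + if i = j then 1 else 0 := by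
  have h := RingQuot.mkAlgHom_rel K (WeylRel.del_x (K := K) i j)
  rw [map_mul, map_add, map_mul] at h
  have e : RingQuot.mkAlgHom K (WeylRel K ι) (if i = j then 1 else 0) =
      (if i = j then 1 else 0 : Weyl K ι) := by
    split_ifs
    · exact map_one _
    · exact map_zero _
  rw [e] at h
  exact h

variable {K}

lemma weyl_induction {P : Weyl K ι → Prop}
    (h0 : ∀ c : K, P (algebraMap K (Weyl K ι) c)) (hx : ∀ i, P (x K i)) (hd : ∀ i, P (del K i))
    (hadd : ∀ a b, P a → P b → P (a + b)) (hmul : ∀ a b, P a → P b → P (a * b))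
    (a : Weyl K ι) : P a := by
  obtain ⟨b, rfl⟩ := RingQuot.mkAlgHom_surjective K (WeylRel K ι) a
  induction b using FreeAlgebra.induction with
  | grade0 r => rw [AlgHom.commutes]; exact h0 r
  | grade1 s =>
    cases s with
    | inl i => exact hx i
    | inr i => exact hd i
  | mul a b ha hb => rw [map_mul]; exact hmul _ _ ha hb
  | add a b ha hb => rw [map_add]; exact hadd _ _ ha hb

end Weyl

section Main

variable {K : Type u} [Field K] {ι : Type} [Fintype ι] [DecidableEq ι]

/-! ## The Euler field and the grading with `deg xᵢ = dᵢ`, `deg ∂ᵢ = -dᵢ` -/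

/-- The Euler field `E = ∑ᵢ dᵢ xᵢ ∂ᵢ`. -/
def euler (K : Type u) [Field K] (d : ι → ℕ) : Weyl K ι :=
  ∑ i, (d i : Weyl K ι) * (x K i * del K i)

/-- The degree of a generator: `deg xᵢ = dᵢ` and `deg ∂ᵢ = -dᵢ`. -/
def genDegree (d : ι → ℕ) : ι ⊕ ι → ℤ :=
  Sum.elim (fun i => (d i : ℤ)) (fun i => -(d i : ℤ))

/-- The homogeneous part of degree `k` of the Weyl algebra: the span of the words of degree `k`
in the generators. -/
def homogeneousPart (K : Type u) [Field K] (d : ι → ℕ) (k : ℤ) : Submodule K (Weyl K ι) :=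
  Submodule.span K {a | ∃ w : List (ι ⊕ ι), (w.map (genDegree d)).sum = k ∧ (w.map (gen K)).prod = a}

lemma euler_comm_x (d : ι → ℕ) (i : ι) :
    euler K d * x K i = x K i * euler K d + algebraMap K _ (d i : K) * x K i := by
  have h : ∀ j, (d j : Weyl K ι) * (x K j * del K j) * x K i =
      x K i * ((d j : Weyl K ι) * (x K j * del K j)) +
        if j = i then (d j : Weyl K ι) * x K j else 0 := by
    intro j
    have e1 : x K i * ((d j : Weyl K ι) * (x K j * del K j)) =
        (d j : Weyl K ι) * (x K j * (x K i * del K j)) := by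
      rw [← mul_assoc (x K i), ← Nat.cast_comm, mul_assoc, ← mul_assoc (x K i), x_mul_x, mul_assoc]
    rw [e1, mul_assoc, mul_assoc, del_mul_x]
    split_ifs <;> simp [mul_add]
  rw [euler, Finset.sum_mul, Finset.sum_congr rfl (fun j _ => h j), Finset.sum_add_distrib,
    Finset.mul_sum]
  simp

lemma euler_comm_del (d : ι → ℕ) (i : ι) :
    euler K d * del K i = del K i * euler K d + algebraMap K _ (-(d i : K)) * del K i := by
  have h : ∀ j, (d j : Weyl K ι) * (x K j * del K j) * del K i =
      del K i * ((d j : Weyl K ι) * (x K j * del K j)) +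
        if j = i then -((d j : Weyl K ι) * del K j) else 0 := by
    intro j
    have e1 : del K i * ((d j : Weyl K ι) * (x K j * del K j)) =
        (d j : Weyl K ι) * ((del K i * x K j) * del K j) := by
      rw [← mul_assoc (del K i), ← Nat.cast_comm, mul_assoc, mul_assoc]
    rw [e1, mul_assoc, mul_assoc, del_mul_x, del_mul_del, add_mul, mul_add, mul_assoc]
    by_cases hij : j = i
    · subst hij; simp
    · simp [hij, Ne.symm hij]
  rw [euler, Finset.sum_mul, Finset.sum_congr rfl (fun j _ => h j), Finset.sum_add_distrib,
    Finset.mul_sum]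
  simp

lemma euler_comm_gen (d : ι → ℕ) (s : ι ⊕ ι) :
    euler K d * gen K s = gen K s * euler K d + algebraMap K _ (genDegree d s : K) * gen K s := by
  cases s with
  | inl i => simpa [genDegree, x] using euler_comm_x (K := K) d i
  | inr i => simpa [genDegree, del] using euler_comm_del (K := K) d i

lemma euler_comm_of_mem (d : ι → ℕ) {k : ℤ} {a : Weyl K ι} (ha : a ∈ homogeneousPart K d k) :
    euler K d * a = a * euler K d + algebraMap K _ (k : K) * a := by
  induction ha using Submodule.span_induction with
  | mem a ha =>
    obtain ⟨w, rfl, rfl⟩ := ha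
    induction w with
    | nil => simp
    | cons s w ih =>
      simp only [List.map_cons, List.prod_cons, List.sum_cons, Int.cast_add, map_add]
      rw [← mul_assoc, euler_comm_gen, add_mul, mul_assoc, ih, mul_add, mul_assoc, mul_assoc,
        ← mul_assoc (gen K s) (algebraMap K _ _), ← Algebra.commutes, mul_assoc, add_mul]
      abel
  | zero => simp
  | add a b _ _ ha hb => rw [mul_add, ha, hb, add_mul, mul_add]; abel
  | smul c a _ ha =>
    rw [mul_smul_comm, ha, smul_add, smul_mul_assoc, mul_smul_comm]

lemma mul_mem_homogeneousPart (d : ι → ℕ) {k l : ℤ} {a b : Weyl K ι}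
    (ha : a ∈ homogeneousPart K d k) (hb : b ∈ homogeneousPart K d l) :
    a * b ∈ homogeneousPart K d (k + l) := by
  induction ha using Submodule.span_induction with
  | mem a ha =>
    obtain ⟨w, rfl, rfl⟩ := ha
    induction hb using Submodule.span_induction with
    | mem b hb =>
      obtain ⟨v, rfl, rfl⟩ := hb
      exact Submodule.subset_span ⟨w ++ v, by simp, by simp⟩
    | zero => simp
    | add a b _ _ ha hb => rw [mul_add]; exact add_mem ha hb
    | smul c a _ ha => rw [mul_smul_comm]; exact Submodule.smul_mem _ _ ha
  | zero => simp
  | add a b _ _ ha hb => rw [add_mul]; exact add_mem ha hb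
  | smul c a _ ha => rw [smul_mul_assoc]; exact Submodule.smul_mem _ _ ha

/-- The subalgebra of elements of degree zero in the Weyl algebra. -/
def degreeZero (K : Type u) [Field K] (d : ι → ℕ) : Subalgebra K (Weyl K ι) where
  carrier := homogeneousPart K d 0
  mul_mem' ha hb := by simpa using mul_mem_homogeneousPart d ha hb
  add_mem' ha hb := add_mem ha hb
  algebraMap_mem' c := by
    rw [Algebra.algebraMap_eq_smul_one]
    exact Submodule.smul_mem _ _ (Submodule.subset_span ⟨[], by simp, by simp⟩)

lemma euler_mem_degreeZero (d : ι → ℕ) : euler K d ∈ degreeZero K d := by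
  refine sum_mem fun i _ => mul_mem (natCast_mem _ _) ?_
  exact Submodule.subset_span ⟨[Sum.inl i, Sum.inr i], by simp [genDegree], by simp [x, del]⟩

/-- The element `E - λ` of the degree zero subalgebra. -/
def eulerSub (d : ι → ℕ) (lam : K) : degreeZero K d :=
  ⟨euler K d, euler_mem_degreeZero d⟩ - algebraMap K _ lam

lemma eulerSub_comm (d : ι → ℕ) (lam : K) (a : degreeZero K d) :
    a * eulerSub d lam = eulerSub d lam * a := by
  have h := euler_comm_of_mem d a.2
  have h' : a * (⟨euler K d, euler_mem_degreeZero d⟩ : degreeZero K d) =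
      ⟨euler K d, euler_mem_degreeZero d⟩ * a := by
    apply Subtype.ext
    simpa using h.symm
  rw [eulerSub, mul_sub, sub_mul, h', Algebra.commutes]

/-- The (left, hence two-sided) ideal `𝐃₀ (E - λ)` of `𝐃₀`. -/
def eulerIdeal (d : ι → ℕ) (lam : K) : Ideal (degreeZero K d) :=
  Ideal.span {eulerSub d lam}

instance (d : ι → ℕ) (lam : K) : (eulerIdeal d lam).IsTwoSided where
  mul_mem_of_left {a} b ha := by
    obtain ⟨c, rfl⟩ := Ideal.mem_span_singleton'.1 ha
    refine Ideal.mem_span_singleton'.2 ⟨c * b, ?_⟩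
    rw [mul_assoc, mul_assoc, eulerSub_comm]

/-- The ring `𝐃₀ / 𝐃₀ (E - λ)` of globally defined twisted differential operators. -/
abbrev TwistedOps (d : ι → ℕ) (lam : K) : Type u := degreeZero K d ⧸ eulerIdeal d lam

/-! ## `λ`-Euler modules -/

/-- The eigenspace of the Euler field with eigenvalue `μ`. -/
def weightSpace (d : ι → ℕ) (μ : K) (M : Type u) [AddCommGroup M] [Module (Weyl K ι) M] :
    AddSubgroup M where
  carrier := {m | euler K d • m = algebraMap K (Weyl K ι) μ • m}
  add_mem' {a b} ha hb := by
    simp only [Set.mem_ofPred_eq] at ha hb ⊢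
    rw [smul_add, smul_add, ha, hb]
  zero_mem' := by simp
  neg_mem' {a} ha := by
    simp only [Set.mem_ofPred_eq] at ha ⊢
    rw [smul_neg, smul_neg, ha]

/-- `M` is `λ`-Euler if it is the sum of the eigenspaces of `E` for the eigenvalues `λ + k`,
`k ∈ ℤ`. (In characteristic zero these eigenvalues are distinct, so that the sum is direct.) -/
def IsEuler (d : ι → ℕ) (lam : K) (M : Type u) [AddCommGroup M] [Module (Weyl K ι) M] : Prop :=
  ⨆ k : ℤ, weightSpace d (lam + k) M = ⊤

section ModuleFacts

variable {M : Type u} [AddCommGroup M] [Module (Weyl K ι) M]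
  {N : Type u} [AddCommGroup N] [Module (Weyl K ι) N]

lemma smul_mem_weightSpace (d : ι → ℕ) {μ : K} {k : ℤ} {a : Weyl K ι} {m : M}
    (ha : a ∈ homogeneousPart K d k) (hm : m ∈ weightSpace d μ M) :
    a • m ∈ weightSpace d (μ + k) M := by
  change euler K d • m = _ at hm
  change euler K d • (a • m) = _
  rw [smul_smul, euler_comm_of_mem d ha, add_smul, mul_smul, hm, smul_smul, ← Algebra.commutes,
    mul_smul, map_add, add_smul, mul_smul]

lemma map_mem_weightSpace (d : ι → ℕ) {μ : K} (f : M →ₗ[Weyl K ι] N) {m : M}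
    (hm : m ∈ weightSpace d μ M) : f m ∈ weightSpace d μ N := by
  change euler K d • m = _ at hm
  change euler K d • f m = _
  rw [← map_smul, hm, map_smul]

end ModuleFacts

instance (d : ι → ℕ) (μ : K) (M : Type u) [AddCommGroup M] [Module (Weyl K ι) M] :
    Module (degreeZero K d) (weightSpace d μ M) where
  smul a m := ⟨(a : Weyl K ι) • (m : M), by
    simpa using smul_mem_weightSpace d (k := 0) a.2 m.2⟩
  one_smul m := Subtype.ext (one_smul (Weyl K ι) (m : M))
  mul_smul a b m := Subtype.ext (mul_smul (a : Weyl K ι) (b : Weyl K ι) (m : M))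
  smul_zero a := Subtype.ext (smul_zero (a : Weyl K ι))
  smul_add a m m' := Subtype.ext (smul_add (a : Weyl K ι) (m : M) (m' : M))
  add_smul a b m := Subtype.ext (add_smul (a : Weyl K ι) (b : Weyl K ι) (m : M))
  zero_smul m := Subtype.ext (zero_smul (Weyl K ι) (m : M))

lemma coe_degreeZero_smul (d : ι → ℕ) (μ : K) (M : Type u) [AddCommGroup M]
    [Module (Weyl K ι) M] (a : degreeZero K d) (m : weightSpace d μ M) :
    ((a • m : weightSpace d μ M) : M) = (a : Weyl K ι) • (m : M) := rfl

/-- The action of `𝐃₀ / 𝐃₀ (E - λ)` on the `λ`-eigenspace of `E` by additive endomorphisms. -/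
def twistedAction (d : ι → ℕ) (lam : K) (M : Type u) [AddCommGroup M] [Module (Weyl K ι) M] :
    TwistedOps d lam →+* AddMonoid.End (weightSpace d lam M) :=
  Ideal.Quotient.lift (eulerIdeal d lam)
    (Module.toAddMonoidEnd (degreeZero K d) (weightSpace d lam M)) (by
      intro a ha
      obtain ⟨c, rfl⟩ := Ideal.mem_span_singleton'.1 ha
      ext m
      have hm : euler K d • (m : M) = algebraMap K (Weyl K ι) lam • (m : M) := m.2
      change (((c : Weyl K ι) * (euler K d - algebraMap K (Weyl K ι) lam)) • (m : M)) = 0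
      rw [mul_smul, sub_smul, hm, sub_self, smul_zero])

instance (d : ι → ℕ) (lam : K) (M : Type u) [AddCommGroup M] [Module (Weyl K ι) M] :
    Module (TwistedOps d lam) (weightSpace d lam M) :=
  Module.compHom _ (twistedAction d lam M)

lemma coe_twistedOps_smul (d : ι → ℕ) (lam : K) (M : Type u) [AddCommGroup M]
    [Module (Weyl K ι) M] (a : degreeZero K d) (m : weightSpace d lam M) :
    (((Ideal.Quotient.mk (eulerIdeal d lam) a) • m : weightSpace d lam M) : M) =
      (a : Weyl K ι) • (m : M) := rfl

/-! ## Torsion -/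

section Torsion

variable {M : Type u} [AddCommGroup M] [Module (Weyl K ι) M]
  {N : Type u} [AddCommGroup N] [Module (Weyl K ι) N]

/-- The monomial in the `xᵢ` given by a word. -/
def monomialX (K : Type u) [Field K] (w : List ι) : Weyl K ι := (w.map (x K)).prod

lemma monomialX_nil : monomialX K ([] : List ι) = 1 := rfl

lemma monomialX_cons (i : ι) (w : List ι) : monomialX K (i :: w) = x K i * monomialX K w := by
  simp [monomialX]

lemma monomialX_append (v w : List ι) :
    monomialX K (v ++ w) = monomialX K v * monomialX K w := by
  simp [monomialX]

lemma monomialX_mono {L : Submodule (Weyl K ι) M} {k l : ℕ} (hkl : k ≤ l) {m : M}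
    (h : ∀ w : List ι, w.length = k → monomialX K w • m ∈ L) :
    ∀ w : List ι, w.length = l → monomialX K w • m ∈ L := by
  intro w hw
  rw [← List.take_append_drop (l - k) w, monomialX_append, mul_smul]
  exact L.smul_mem _ (h _ (by rw [List.length_drop]; omega))

lemma monomialX_del {L : Submodule (Weyl K ι) M} (i : ι) (k : ℕ) : ∀ (m : M),
    (∀ w : List ι, w.length = k → monomialX K w • m ∈ L) →
    ∀ w : List ι, w.length = k + 1 → monomialX K w • (del K i • m) ∈ L := by
  induction k with
  | zero =>
    intro m h w _
    have hm : m ∈ L := by simpa [monomialX_nil] using h [] rfl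
    exact L.smul_mem _ (L.smul_mem _ hm)
  | succ k ih =>
    intro m h w hw
    obtain ⟨v, j, rfl⟩ : ∃ v j, w = v ++ [j] := by
      rcases List.eq_nil_or_concat w with h0 | ⟨v, j, h0⟩
      · simp [h0] at hw
      · exact ⟨v, j, by simpa using h0⟩
    have hv : v.length = k + 1 := by simpa using hw
    have e : monomialX K (v ++ [j]) • (del K i • m) =
        monomialX K v • (del K i • (x K j • m)) -
          (if i = j then (1 : Weyl K ι) else 0) • (monomialX K v • m) := by
      have e1 : x K j • (del K i • m) = del K i • (x K j • m) -
          (if i = j then (1 : Weyl K ι) else 0) • m := by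
        rw [smul_smul, smul_smul, del_mul_x, add_smul, add_sub_cancel_right]
      rw [monomialX_append, mul_smul]
      simp only [monomialX_cons, monomialX_nil, mul_one]
      rw [e1, smul_sub]
      split_ifs <;> simp
    rw [e]
    refine L.sub_mem (ih _ (fun u hu => ?_) v hv) (L.smul_mem _ (h v hv))
    have := h (u ++ [j]) (by simp [hu])
    rwa [monomialX_append, mul_smul, monomialX_cons, monomialX_nil, mul_one] at this

/-- `{m | ∃ k, Jᵏ m ⊆ L}`, where `J` is the ideal `(x₀, …, xₙ)` of the polynomial ring; note that
the ideal `Jᵏ` is generated by the monomials given by words of length `k`. -/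
def torsionModulo (L : Submodule (Weyl K ι) M) : Submodule (Weyl K ι) M where
  carrier := {m | ∃ k : ℕ, ∀ w : List ι, w.length = k → monomialX K w • m ∈ L}
  zero_mem' := ⟨0, fun w _ => by simp⟩
  add_mem' := by
    rintro a b ⟨k, hk⟩ ⟨l, hl⟩
    refine ⟨max k l, fun w hw => ?_⟩
    rw [smul_add]
    exact L.add_mem (monomialX_mono (le_max_left k l) hk w hw)
      (monomialX_mono (le_max_right k l) hl w hw)
  smul_mem' := by
    intro a
    induction a using weyl_induction with
    | h0 c =>
      rintro m ⟨k, hk⟩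
      refine ⟨k, fun w hw => ?_⟩
      rw [smul_smul, ← Algebra.commutes, mul_smul]
      exact L.smul_mem _ (hk w hw)
    | hx i =>
      rintro m ⟨k, hk⟩
      refine ⟨k, fun w hw => ?_⟩
      have := monomialX_mono (Nat.le_succ k) hk (w ++ [i]) (by simp [hw])
      rwa [monomialX_append, mul_smul, monomialX_cons, monomialX_nil, mul_one] at this
    | hd i =>
      rintro m ⟨k, hk⟩
      exact ⟨k + 1, monomialX_del i k m hk⟩
    | hadd a b ha hb =>
      intro m hm
      obtain ⟨k, hk⟩ := ha hm
      obtain ⟨l, hl⟩ := hb hm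
      refine ⟨max k l, fun w hw => ?_⟩
      rw [add_smul, smul_add]
      exact L.add_mem (monomialX_mono (le_max_left k l) hk w hw)
        (monomialX_mono (le_max_right k l) hl w hw)
    | hmul a b ha hb =>
      intro m hm
      have := ha (hb hm)
      rwa [smul_smul] at this

lemma mem_torsionModulo {L : Submodule (Weyl K ι) M} {m : M} :
    m ∈ torsionModulo L ↔ ∃ k : ℕ, ∀ w : List ι, w.length = k → monomialX K w • m ∈ L := Iff.rfl

variable (K ι M) in
/-- The torsion submodule `τ(M) = {m | ∃ k, Jᵏ m = 0}`. -/
def torsionSubmodule : Submodule (Weyl K ι) M := torsionModulo ⊥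

variable (K ι M) in
/-- `M` is a torsion module if `τ(M) = M`. -/
def IsTorsion : Prop := torsionSubmodule K ι M = ⊤

lemma le_torsionModulo (L : Submodule (Weyl K ι) M) : L ≤ torsionModulo L :=
  fun _ hm => ⟨0, fun _ _ => L.smul_mem _ hm⟩

lemma torsionModulo_mono {L L' : Submodule (Weyl K ι) M} (h : L ≤ L') :
    torsionModulo L ≤ torsionModulo L' :=
  fun _ ⟨k, hk⟩ => ⟨k, fun w hw => h (hk w hw)⟩

lemma torsionModulo_idem (L : Submodule (Weyl K ι) M) :
    torsionModulo (torsionModulo L) = torsionModulo L := by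
  refine le_antisymm ?_ (le_torsionModulo _)
  rintro m ⟨k, hk⟩
  have hk' : ∀ w : List ι, w.length = k →
      ∃ l : ℕ, ∀ v : List ι, v.length = l → monomialX K v • (monomialX K w • m) ∈ L := hk
  choose! l hl using hk'
  obtain ⟨B, hB⟩ := ((List.finite_length_eq ι k).image l).bddAbove
  refine ⟨B + k, fun w hw => ?_⟩
  rw [← List.take_append_drop B w, monomialX_append, mul_smul]
  have h1 : (w.drop B).length = k := by rw [List.length_drop]; omega
  have h2 : l (w.drop B) ≤ B := hB ⟨_, h1, rfl⟩
  exact monomialX_mono h2 (hl _ h1) _ (by rw [List.length_take]; omega)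

lemma map_mem_torsionModulo (f : M →ₗ[Weyl K ι] N) {L : Submodule (Weyl K ι) M}
    {L' : Submodule (Weyl K ι) N} (h : ∀ m ∈ L, f m ∈ L') {m : M} (hm : m ∈ torsionModulo L) :
    f m ∈ torsionModulo L' := by
  obtain ⟨k, hk⟩ := hm
  exact ⟨k, fun w hw => by rw [← map_smul]; exact h _ (hk w hw)⟩

lemma mem_torsionModulo_of_map (f : M →ₗ[Weyl K ι] N) {L : Submodule (Weyl K ι) M}
    {L' : Submodule (Weyl K ι) N} (h : ∀ m, f m ∈ L' → m ∈ L) {m : M}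
    (hm : f m ∈ torsionModulo L') : m ∈ torsionModulo L := by
  obtain ⟨k, hk⟩ := hm
  exact ⟨k, fun w hw => h _ (by rw [map_smul]; exact hk w hw)⟩

lemma isTorsion_ker_iff (f : M →ₗ[Weyl K ι] N) :
    IsTorsion K ι (LinearMap.ker f) ↔ ∀ m, f m = 0 → m ∈ torsionSubmodule K ι M := by
  constructor
  · intro h m hm
    have h1 : (⟨m, hm⟩ : LinearMap.ker f) ∈ torsionSubmodule K ι (LinearMap.ker f) := by
      rw [h]; trivial
    exact map_mem_torsionModulo (LinearMap.ker f).subtype (by simp) h1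
  · intro h
    refine eq_top_iff.2 fun m _ => ?_
    exact mem_torsionModulo_of_map (LinearMap.ker f).subtype (L' := ⊥) (by simp) (h m.1 m.2)

lemma isTorsion_quotient_iff (L : Submodule (Weyl K ι) N) :
    IsTorsion K ι (N ⧸ L) ↔ torsionModulo L = ⊤ := by
  constructor
  · intro h
    refine eq_top_iff.2 fun m _ => ?_
    have h1 : L.mkQ m ∈ torsionSubmodule K ι (N ⧸ L) := by rw [h]; trivial
    exact mem_torsionModulo_of_map L.mkQ (L' := ⊥) (by simp) h1
  · intro h
    refine eq_top_iff.2 fun m _ => ?_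
    obtain ⟨m, rfl⟩ := L.mkQ_surjective m
    have h1 : m ∈ torsionModulo L := by rw [h]; trivial
    exact map_mem_torsionModulo L.mkQ (by simp) h1

end Torsion

/-! ## Saturation: every `λ`-Euler module has a torsion-free saturated envelope

The facts in this section serve only to construct the section functor below. -/

lemma exists_essential_retract {R : Type u} [Ring R] {I : Type u} [AddCommGroup I] [Module R I]
    [Module.Injective R I] (N : Submodule R I) :
    ∃ (E : Submodule R I) (r : I →ₗ[R] I), N ≤ E ∧
      (∀ y ∈ E, y ≠ 0 → ∃ a : R, a • y ∈ N ∧ a • y ≠ 0) ∧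
      (∀ y, r y ∈ E) ∧ ∀ y ∈ E, r y = y := by
  obtain ⟨E, hNE, hE⟩ := zorn_le_nonempty₀
    {E : Submodule R I | N ≤ E ∧ ∀ y ∈ E, y ≠ 0 → ∃ a : R, a • y ∈ N ∧ a • y ≠ 0} (by
      intro c hc hchain F hF
      refine ⟨sSup c, ⟨(hc hF).1.trans (le_sSup hF), fun y hy hy0 => ?_⟩, fun _ h => le_sSup h⟩
      obtain ⟨G, hG, hyG⟩ := (Submodule.mem_sSup_of_directed ⟨F, hF⟩ hchain.directedOn).1 hy
      exact (hc hG).2 y hyG hy0) N ⟨le_rfl, fun y hy hy0 => ⟨1, by simpa using hy, by simpa⟩⟩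
  obtain ⟨C, -, hC⟩ := zorn_le_nonempty₀
    {C : Submodule R I | ∀ y ∈ C, y ∈ E → y = 0} (by
      intro c hc hchain F hF
      refine ⟨sSup c, fun y hy hyE => ?_, fun _ h => le_sSup h⟩
      obtain ⟨G, hG, hyG⟩ := (Submodule.mem_sSup_of_directed ⟨F, hF⟩ hchain.directedOn).1 hy
      exact hc hG y hyG hyE) ⊥ (fun y hy _ => by simpa using hy)
  have hinj : Function.Injective (C.mkQ ∘ₗ E.subtype) := by
    rw [← LinearMap.ker_eq_bot, LinearMap.ker_eq_bot']
    intro e he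
    have he' : (e : I) ∈ C := by simpa using he
    exact Subtype.ext (hC.prop _ he' e.2)
  obtain ⟨φ, hφ⟩ := Module.Injective.out (C.mkQ ∘ₗ E.subtype) hinj E.subtype
  have hφE : ∀ e ∈ E, φ (C.mkQ e) = e := fun e he => hφ ⟨e, he⟩
  have key : ∀ y, C.mkQ y ≠ 0 → ∃ a : R, a • φ (C.mkQ y) ∈ E ∧ a • φ (C.mkQ y) ≠ 0 := by
    intro y hy
    have hyC : y ∉ C := by simpa using hy
    have hnot : ¬ ∀ z ∈ C ⊔ R ∙ y, z ∈ E → z = 0 := by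
      intro h
      exact hyC (hC.le_of_ge h le_sup_left
        (Submodule.mem_sup_right (Submodule.mem_span_singleton_self y)))
    push Not at hnot
    obtain ⟨z, hz, hzE, hz0⟩ := hnot
    obtain ⟨c, hc, v, hv, rfl⟩ := Submodule.mem_sup.1 hz
    obtain ⟨a, rfl⟩ := Submodule.mem_span_singleton.1 hv
    have h1 : a • φ (C.mkQ y) = c + a • y := by
      rw [← map_smul, ← map_smul, ← hφE _ hzE, map_add]
      have : C.mkQ c = 0 := by simpa using hc
      rw [this, zero_add]
    exact ⟨a, by rw [h1]; exact hzE, by rw [h1]; exact hz0⟩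
  refine ⟨E, φ ∘ₗ C.mkQ, hNE, hE.prop.2, ?_, hφE⟩
  have hle : E ≤ LinearMap.range (φ ∘ₗ C.mkQ) := fun e he => ⟨e, hφE e he⟩
  have hge := hE.le_of_ge (y := LinearMap.range (φ ∘ₗ C.mkQ)) ⟨hNE.trans hle, by
    rintro _ ⟨y, rfl⟩ hy0
    have hy : C.mkQ y ≠ 0 := by
      intro h
      apply hy0
      rw [LinearMap.comp_apply, h, map_zero]
    obtain ⟨a, ha, ha0⟩ := key y hy
    obtain ⟨b, hb, hb0⟩ := hE.prop.2 _ ha ha0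
    exact ⟨b * a, by rw [mul_smul]; exact hb, by rw [mul_smul]; exact hb0⟩⟩ hle
  exact fun y => hge ⟨y, rfl⟩

section Saturation

variable {M : Type u} [AddCommGroup M] [Module (Weyl K ι) M]

/-- The `λ`-Euler part of a submodule `P`: the sum of the `E`-eigenspaces of `P` for the
eigenvalues `λ + k`, `k ∈ ℤ`. -/
def eulerPart (d : ι → ℕ) (lam : K) (P : Submodule (Weyl K ι) M) : Submodule (Weyl K ι) M where
  __ := AddSubgroup.closure {m | m ∈ P ∧ ∃ k : ℤ, m ∈ weightSpace d (lam + k) M}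
  smul_mem' := by
    have hgen : ∀ (s : ι ⊕ ι) (m : M),
        m ∈ AddSubgroup.closure {m | m ∈ P ∧ ∃ k : ℤ, m ∈ weightSpace d (lam + k) M} →
        gen K s • m ∈
          AddSubgroup.closure {m | m ∈ P ∧ ∃ k : ℤ, m ∈ weightSpace d (lam + k) M} := by
      intro s m hm
      induction hm using AddSubgroup.closure_induction with
      | mem m hm =>
        obtain ⟨hP, k, hk⟩ := hm
        refine AddSubgroup.subset_closure ⟨P.smul_mem _ hP, k + genDegree d s, ?_⟩
        have := smul_mem_weightSpace d (k := genDegree d s) (a := gen K s)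
          (Submodule.subset_span ⟨[s], by simp, by simp⟩) hk
        simpa [add_assoc] using this
      | zero => rw [smul_zero]; exact zero_mem _
      | add a b _ _ ha hb => rw [smul_add]; exact add_mem ha hb
      | neg a _ ha => rw [smul_neg]; exact neg_mem ha
    intro a
    induction a using weyl_induction with
    | h0 c =>
      intro m hm
      change m ∈ AddSubgroup.closure _ at hm
      change _ ∈ AddSubgroup.closure _
      induction hm using AddSubgroup.closure_induction with
      | mem m hm =>
        obtain ⟨hP, k, hk⟩ := hm
        refine AddSubgroup.subset_closure ⟨P.smul_mem _ hP, k, ?_⟩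
        change euler K d • m = _ at hk
        change euler K d • (_ • m) = _
        rw [smul_smul, ← Algebra.commutes, mul_smul, hk, smul_smul, smul_smul, Algebra.commutes]
      | zero => rw [smul_zero]; exact zero_mem _
      | add a b _ _ ha hb => rw [smul_add]; exact add_mem ha hb
      | neg a _ ha => rw [smul_neg]; exact neg_mem ha
    | hx i => exact fun {m} hm => hgen (Sum.inl i) m hm
    | hd i => exact fun {m} hm => hgen (Sum.inr i) m hm
    | hadd a b ha hb =>
      intro m hm
      rw [add_smul]
      exact add_mem (S := AddSubgroup M) (ha hm) (hb hm)
    | hmul a b ha hb =>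
      intro m hm
      rw [mul_smul]
      exact ha (hb hm)

lemma eulerPart_le (d : ι → ℕ) (lam : K) (P : Submodule (Weyl K ι) M) :
    eulerPart d lam P ≤ P :=
  fun _ hm => (AddSubgroup.closure_le P.toAddSubgroup).2 (fun _ h => h.1) hm

lemma isEuler_eulerPart (d : ι → ℕ) (lam : K) (P : Submodule (Weyl K ι) M) :
    IsEuler d lam (eulerPart d lam P) := by
  refine eq_top_iff.2 ?_
  have h : ∀ m (hm : m ∈ AddSubgroup.closure
      {m | m ∈ P ∧ ∃ k : ℤ, m ∈ weightSpace d (lam + k) M}),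
      (⟨m, hm⟩ : eulerPart d lam P) ∈ ⨆ k : ℤ, weightSpace d (lam + k) (eulerPart d lam P) := by
    intro m hm
    induction hm using AddSubgroup.closure_induction with
    | mem m hm =>
      obtain ⟨hP, k, hk⟩ := hm
      exact AddSubgroup.mem_iSup_of_mem k (Subtype.ext hk)
    | zero => exact zero_mem _
    | add a b _ _ ha hb => exact add_mem ha hb
    | neg a _ ha => exact neg_mem ha
  exact fun m _ => h m.1 m.2

lemma map_mem_eulerPart (d : ι → ℕ) (lam : K) {N : Type u} [AddCommGroup N] [Module (Weyl K ι) N]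
    (hN : IsEuler d lam N) (P : Submodule (Weyl K ι) M) (f : N →ₗ[Weyl K ι] M)
    (hf : ∀ n, f n ∈ P) (n : N) : f n ∈ eulerPart d lam P := by
  have hn : n ∈ ⨆ k : ℤ, weightSpace d (lam + k) N := by rw [hN]; trivial
  refine AddSubgroup.iSup_induction (fun k : ℤ => weightSpace d (lam + k) N)
    (C := fun n => f n ∈ eulerPart d lam P) hn ?_ ?_ ?_
  · exact fun k n hn => AddSubgroup.subset_closure ⟨hf n, k, map_mem_weightSpace d f hn⟩
  · rw [map_zero]; exact zero_mem _
  · intro a b ha hb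
    rw [map_add]; exact add_mem ha hb

/-- Existence of saturations. -/
lemma exists_saturation (d : ι → ℕ) (lam : K) (hM : IsEuler d lam M) :
    ∃ (S : ModuleCat.{u} (Weyl K ι)) (g : M →ₗ[Weyl K ι] S), IsEuler d lam S ∧
      IsTorsion K ι (LinearMap.ker g) ∧ IsTorsion K ι (S ⧸ LinearMap.range g) ∧
      ∀ (N N' : Type u) [AddCommGroup N] [Module (Weyl K ι) N] [AddCommGroup N']
        [Module (Weyl K ι) N'] (f : N →ₗ[Weyl K ι] N'), IsEuler d lam N' →
        IsTorsion K ι (LinearMap.ker f) → IsTorsion K ι (N' ⧸ LinearMap.range f) →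
        Function.Bijective (fun h : N' →ₗ[Weyl K ι] S => h ∘ₗ f) := by
  -- an injective module containing `M / τ(M)`
  obtain ⟨⟨I, hI, β, hβ⟩⟩ := (ModuleCat.enoughInjectives.{u} (R := Weyl K ι)).presentation
    (ModuleCat.of (Weyl K ι) (M ⧸ torsionSubmodule K ι M))
  have : Module.Injective (Weyl K ι) I := Module.injective_module_of_injective_object _ _
  have hβ' : Function.Injective β.hom := (ModuleCat.mono_iff_injective β).1 hβ
  let α : M →ₗ[Weyl K ι] I := β.hom ∘ₗ (torsionSubmodule K ι M).mkQ
  have hα : ∀ m, α m = 0 ↔ m ∈ torsionSubmodule K ι M := by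
    intro m
    change β.hom _ = 0 ↔ _
    rw [map_eq_zero_iff _ hβ']
    simp
  obtain ⟨E, r, hNE, hess, hrE, hrid⟩ := exists_essential_retract (LinearMap.range α)
  let P := E ⊓ torsionModulo (LinearMap.range α)
  -- `E` is torsion-free
  have hfree : ∀ y ∈ E, y ∈ torsionSubmodule K ι I → y = 0 := by
    intro y hy hyt
    by_contra hy0
    obtain ⟨a, ⟨m, hm⟩, ha0⟩ := hess y hy hy0
    have h1 : α m ∈ torsionSubmodule K ι I := by
      rw [hm]; exact Submodule.smul_mem _ _ hyt
    have h2 : m ∈ torsionModulo (torsionSubmodule K ι M) :=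
      mem_torsionModulo_of_map α (L' := ⊥) (fun m hm => (hα m).1 (by simpa using hm)) h1
    rw [torsionSubmodule, torsionModulo_idem] at h2
    exact ha0 (by rw [← hm]; exact (hα m).2 h2)
  have hαP : ∀ m, α m ∈ P := fun m => ⟨hNE ⟨m, rfl⟩, le_torsionModulo _ ⟨m, rfl⟩⟩
  let g : M →ₗ[Weyl K ι] eulerPart d lam P :=
    α.codRestrict _ (map_mem_eulerPart d lam hM P α hαP)
  have hSfree : ∀ s : eulerPart d lam P, s ∈ torsionSubmodule K ι (eulerPart d lam P) → s = 0 := by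
    intro s hs
    refine Subtype.ext (hfree s (eulerPart_le d lam P s.2).1 ?_)
    exact map_mem_torsionModulo (eulerPart d lam P).subtype (by simp) hs
  refine ⟨ModuleCat.of _ (eulerPart d lam P), g, isEuler_eulerPart d lam P, ?_, ?_, ?_⟩
  · rw [isTorsion_ker_iff]
    intro m hm
    exact (hα m).1 (congrArg Subtype.val hm)
  · rw [isTorsion_quotient_iff]
    refine eq_top_iff.2 fun s _ => ?_
    refine mem_torsionModulo_of_map (eulerPart d lam P).subtype (L' := LinearMap.range α) ?_
      (eulerPart_le d lam P s.2).2
    rintro s ⟨m, hm⟩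
    exact ⟨m, Subtype.ext hm⟩
  · intro N N' _ _ _ _ f hN' hker hcoker
    rw [isTorsion_ker_iff] at hker
    rw [isTorsion_quotient_iff] at hcoker
    constructor
    · intro h₁ h₂ h12
      refine sub_eq_zero.1 (LinearMap.ext fun n' => hSfree _ ?_)
      have hn' : n' ∈ torsionModulo (LinearMap.range f) := by rw [hcoker]; trivial
      refine map_mem_torsionModulo (h₁ - h₂) ?_ hn'
      rintro _ ⟨n, rfl⟩
      have := LinearMap.congr_fun h12 n
      simpa [sub_eq_zero] using this
    · intro h
      let h' : N →ₗ[Weyl K ι] I := (eulerPart d lam P).subtype ∘ₗ h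
      have hk : LinearMap.ker f ≤ LinearMap.ker h' := by
        intro n hn
        have h1 : h n = 0 := hSfree _ (map_mem_torsionModulo h (by simp) (hker n hn))
        simp [h', h1]
      let h'' : LinearMap.range f →ₗ[Weyl K ι] I :=
        (LinearMap.ker f).liftQ h' hk ∘ₗ f.quotKerEquivRange.symm.toLinearMap
      have hh'' : ∀ n, h'' ⟨f n, ⟨n, rfl⟩⟩ = h n := by
        intro n
        have : f.quotKerEquivRange.symm ⟨f n, ⟨n, rfl⟩⟩ = (LinearMap.ker f).mkQ n :=
          f.quotKerEquivRange_symm_apply_image n ⟨n, rfl⟩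
        simp only [h'', LinearMap.comp_apply, LinearEquiv.coe_coe, this]
        simp [h']
      obtain ⟨H, hH⟩ := Module.Injective.out (LinearMap.range f).subtype
        (Submodule.subtype_injective _) h''
      have hHf : ∀ n, r (H (f n)) = h n := by
        intro n
        have := hH ⟨f n, ⟨n, rfl⟩⟩
        rw [hh''] at this
        change H (f n) = _ at this
        rw [this]
        exact hrid _ (eulerPart_le d lam P (h n).2).1
      have hP : ∀ n', (r ∘ₗ H) n' ∈ P := by
        intro n'
        refine ⟨hrE _, ?_⟩
        rw [← torsionModulo_idem]
        have hn' : n' ∈ torsionModulo (LinearMap.range f) := by rw [hcoker]; trivial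
        refine map_mem_torsionModulo (r ∘ₗ H) ?_ hn'
        rintro _ ⟨n, rfl⟩
        rw [LinearMap.comp_apply, hHf]
        exact (eulerPart_le d lam P (h n).2).2
      refine ⟨(r ∘ₗ H).codRestrict _ (map_mem_eulerPart d lam hN' P _ hP), ?_⟩
      refine LinearMap.ext fun n => Subtype.ext ?_
      exact hHf n

end Saturation

/-! ## The category of `λ`-twisted D-modules on `[P(V)]` and the global sections functor -/

/-- The category `𝐃-Gr^λ` of `λ`-Euler modules, with its canonical grading `Mₖ = M^{λ+k}`; all
`𝐃`-linear maps between such modules preserve this grading. -/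
abbrev EulerMod (d : ι → ℕ) (lam : K) :=
  ObjectProperty.FullSubcategory
    (fun M : ModuleCat.{u} (Weyl K ι) => IsEuler d lam M)

/-- The underlying linear map of a morphism of `λ`-Euler modules. -/
abbrev EulerMod.lin {d : ι → ℕ} {lam : K} {M N : EulerMod d lam} (f : M ⟶ N) :
    M.obj →ₗ[Weyl K ι] N.obj := f.hom.hom

/-- The morphisms of `λ`-Euler modules whose kernel and cokernel are torsion. -/
def torsionIso (d : ι → ℕ) (lam : K) : MorphismProperty (EulerMod d lam) := fun _ N f =>
  IsTorsion K ι (LinearMap.ker (EulerMod.lin f)) ∧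
    IsTorsion K ι (N.obj ⧸ LinearMap.range (EulerMod.lin f))

/-- The category of quasicoherent `λ`-twisted D-modules on the weighted projective stack: the
quotient category `𝐃-Gr^λ / 𝐃-Tors^λ`, that is, the localization of `𝐃-Gr^λ` at the morphisms
with torsion kernel and cokernel. -/
abbrev TwistedDMod (d : ι → ℕ) (lam : K) := (torsionIso d lam).Localization

/-- The quotient functor `π`. -/
abbrev quotientFunctor (d : ι → ℕ) (lam : K) : EulerMod d lam ⥤ TwistedDMod d lam :=
  (torsionIso d lam).Q

lemma exists_saturation_hom (d : ι → ℕ) (lam : K) (M : EulerMod d lam) :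
    ∃ (S : EulerMod d lam) (g : M ⟶ S), torsionIso d lam g ∧ (torsionIso d lam).isLocal S := by
  obtain ⟨S, g, hS, hker, hcoker, hloc⟩ := exists_saturation d lam M.property
  refine ⟨⟨S, hS⟩, ObjectProperty.homMk (ModuleCat.ofHom g), ⟨hker, hcoker⟩, ?_⟩
  intro N N' f hf
  have := hloc N.obj N'.obj (EulerMod.lin f) N'.property hf.1 hf.2
  constructor
  · intro a b hab
    apply ObjectProperty.hom_ext
    apply ModuleCat.hom_ext
    exact this.1 (congrArg EulerMod.lin hab)
  · intro b
    obtain ⟨a, ha⟩ := this.2 (EulerMod.lin b)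
    refine ⟨ObjectProperty.homMk (ModuleCat.ofHom a), ?_⟩
    apply ObjectProperty.hom_ext
    apply ModuleCat.hom_ext
    exact ha

lemma torsionIso_of_isLocal (d : ι → ℕ) (lam : K) {X Y : EulerMod d lam} (f : X ⟶ Y)
    (hf : (torsionIso d lam).isLocal.isLocal f) : torsionIso d lam f := by
  obtain ⟨SX, gX, hgX, hSX⟩ := exists_saturation_hom d lam X
  obtain ⟨SY, gY, hgY, hSY⟩ := exists_saturation_hom d lam Y
  obtain ⟨h, hh⟩ := (hSY gX hgX).2 (f ≫ gY)
  replace hh : gX ≫ h = f ≫ gY := hh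
  have hgX' := MorphismProperty.le_isLocal_isLocal (torsionIso d lam) _ hgX
  have hgY' := MorphismProperty.le_isLocal_isLocal (torsionIso d lam) _ hgY
  have hcomp : (torsionIso d lam).isLocal.isLocal (gX ≫ h) := by
    rw [hh]; exact MorphismProperty.comp_mem _ _ _ hf hgY'
  have hh' := MorphismProperty.of_precomp _ _ _ hgX' hcomp
  rw [ObjectProperty.isLocal_iff_isIso _ _ hSX hSY] at hh'
  have e : ∀ m, EulerMod.lin h (EulerMod.lin gX m) = EulerMod.lin gY (EulerMod.lin f m) :=
    fun m => LinearMap.congr_fun (congrArg EulerMod.lin hh) m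
  have einv : ∀ s, EulerMod.lin (inv h) (EulerMod.lin h s) = s :=
    fun s => LinearMap.congr_fun (congrArg EulerMod.lin (IsIso.hom_inv_id h)) s
  have einv' : ∀ s, EulerMod.lin h (EulerMod.lin (inv h) s) = s :=
    fun s => LinearMap.congr_fun (congrArg EulerMod.lin (IsIso.inv_hom_id h)) s
  obtain ⟨hX1, hX2⟩ := hgX
  obtain ⟨hY1, -⟩ := hgY
  rw [isTorsion_ker_iff] at hX1 hY1
  rw [isTorsion_quotient_iff] at hX2
  refine ⟨?_, ?_⟩
  · rw [isTorsion_ker_iff]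
    intro m hm
    refine hX1 m ?_
    rw [← einv (EulerMod.lin gX m), e, hm, map_zero, map_zero]
  · rw [isTorsion_quotient_iff]
    refine eq_top_iff.2 fun y _ => ?_
    have h1 : EulerMod.lin (inv h) (EulerMod.lin gY y) ∈
        torsionModulo (LinearMap.range (EulerMod.lin gX)) := by rw [hX2]; trivial
    rw [← torsionModulo_idem]
    refine mem_torsionModulo_of_map (EulerMod.lin (inv h) ∘ₗ EulerMod.lin gY) ?_ h1
    rintro z ⟨m, hm⟩
    have h2 : EulerMod.lin gY (z - EulerMod.lin f m) = 0 := by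
      rw [map_sub, ← e, hm, LinearMap.comp_apply, einv', sub_self]
    have h3 : z - EulerMod.lin f m ∈ torsionModulo (LinearMap.range (EulerMod.lin f)) :=
      torsionModulo_mono bot_le (hY1 _ h2)
    have h4 := add_mem h3 (le_torsionModulo _ ⟨m, rfl⟩ :
      EulerMod.lin f m ∈ torsionModulo (LinearMap.range (EulerMod.lin f)))
    rwa [sub_add_cancel] at h4

/-- The saturated modules form a reflective subcategory. -/
lemma isRightAdjoint_ι (d : ι → ℕ) (lam : K) : (torsionIso d lam).isLocal.ι.IsRightAdjoint := by
  have : ∀ A, Limits.HasInitial (StructuredArrow A (torsionIso d lam).isLocal.ι) := by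
    intro A
    obtain ⟨S, g, hg, hS⟩ := exists_saturation_hom d lam A
    let Z : StructuredArrow A (torsionIso d lam).isLocal.ι :=
      StructuredArrow.mk (Y := (⟨S, hS⟩ : (torsionIso d lam).isLocal.FullSubcategory)) g
    have hex : ∀ Y : StructuredArrow A (torsionIso d lam).isLocal.ι, Nonempty (Unique (Z ⟶ Y)) := by
      intro Y
      obtain ⟨h, hh⟩ := (Y.right.property g hg).2 Y.hom
      refine ⟨⟨⟨StructuredArrow.homMk (ObjectProperty.homMk h) hh⟩, fun a => ?_⟩⟩
      apply StructuredArrow.ext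
      apply ObjectProperty.hom_ext
      apply (Y.right.property g hg).1
      exact (StructuredArrow.w a).trans hh.symm
    have := fun Y => (hex Y).some
    exact Limits.hasInitial_of_unique Z
  exact isRightAdjointOfStructuredArrowInitials _

/-- The quotient functor has a right adjoint. -/
instance (d : ι → ℕ) (lam : K) : (quotientFunctor d lam).IsLeftAdjoint := by
  have := isRightAdjoint_ι d lam
  let F := (torsionIso d lam).isLocal.ι
  let adj := Adjunction.ofIsRightAdjoint F
  have hW : torsionIso d lam = ObjectProperty.isLocal (· ∈ Set.range F.obj) := by
    have hr : (· ∈ Set.range F.obj : ObjectProperty (EulerMod d lam)) =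
        (torsionIso d lam).isLocal := by
      ext X
      exact ⟨fun ⟨Y, hY⟩ => hY ▸ Y.property, fun h => ⟨⟨X, h⟩, rfl⟩⟩
    rw [hr]
    exact le_antisymm (MorphismProperty.le_isLocal_isLocal _)
      fun _ _ f hf => torsionIso_of_isLocal d lam f hf
  have hloc : ∀ W, W = ObjectProperty.isLocal (· ∈ Set.range F.obj) →
      F.leftAdjoint.IsLocalization W := by
    rintro _ rfl
    exact ObjectProperty.isLocalization_isLocal adj
  have := hloc _ hW
  let e := Localization.compUniqFunctor F.leftAdjoint (quotientFunctor d lam) (torsionIso d lam)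
  have h := (adj.comp (Localization.uniq F.leftAdjoint (quotientFunctor d lam)
    (torsionIso d lam)).toAdjunction).ofNatIsoLeft e
  exact h.isLeftAdjoint

/-- The section functor `ω`, right adjoint to the quotient functor `π`. -/
def sectionFunctor (d : ι → ℕ) (lam : K) : TwistedDMod d lam ⥤ EulerMod d lam :=
  (quotientFunctor d lam).rightAdjoint

/-- The adjunction `π ⊣ ω`. -/
def sectionAdjunction (d : ι → ℕ) (lam : K) :
    quotientFunctor d lam ⊣ sectionFunctor d lam :=
  Adjunction.ofIsLeftAdjoint _

/-- The functor `M ↦ M₀ = M^λ` from `λ`-Euler modules to modules over `𝐃₀ / 𝐃₀ (E - λ)`. -/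
def degreeZeroFunctor (d : ι → ℕ) (lam : K) :
    EulerMod d lam ⥤ ModuleCat.{u} (TwistedOps d lam) where
  obj M := ModuleCat.of _ (weightSpace d lam M.obj)
  map {M N} f := ModuleCat.ofHom
    { toFun := fun m => ⟨EulerMod.lin f m, map_mem_weightSpace d (EulerMod.lin f) m.2⟩
      map_add' := fun a b => Subtype.ext (map_add (EulerMod.lin f) (a : M.obj) (b : M.obj))
      map_smul' := fun a m => by
        obtain ⟨a, rfl⟩ := Ideal.Quotient.mk_surjective a
        exact Subtype.ext (map_smul (EulerMod.lin f) (a : Weyl K ι) (m : M.obj)) }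

/-- The global sections functor `Γ_λ(ℳ) = ω(ℳ)₀`. -/
def globalSections (d : ι → ℕ) (lam : K) :
    TwistedDMod d lam ⥤ ModuleCat.{u} (TwistedOps d lam) :=
  sectionFunctor d lam ⋙ degreeZeroFunctor d lam

/-- The kernel of `Γ_λ`: the twisted D-modules `ℳ` with `Γ_λ(ℳ) = 0`. -/
def kernelGlobalSections (d : ι → ℕ) (lam : K) : ObjectProperty (TwistedDMod d lam) :=
  fun ℳ => Limits.IsZero ((globalSections d lam).obj ℳ)

end Main
end WeightedDMod

end

namespace WeightedDMod

/-! Twisted D-modules are identified with saturated Euler modules, that is, those into which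
morphisms extend uniquely along maps with torsion kernel and cokernel
(`exists_equivalence_isLocal`). A saturated module has no torsion weight vectors, and Γ_λ reads off
its part of weight λ. So the question is whether a nonzero saturated module can miss the weight λ.

For gcd 1, start from any weight vector and walk to weight λ, using x_i to raise the weight by d_i
and ∂_i to lower it by d_i (`exists_weightSpace_ne_zero`). The difficulty is to keep the vector
nonzero. Choose a largest set S of indices such that some nonzero weight vector is killed by all x_i
with i in S. By maximality the x_j with j outside S never kill such vectors, and S is not everything
because torsion is excluded. If S is nonempty, vectors killed by x_i for i in S look like delta
functions in these variables, so the ∂_i with i in S never kill them or their derivatives. The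
available steps d_j (j outside S) and -d_i (i in S) generate ℤ as a monoid, since both signs occur
and the gcd is 1.

If S is empty, every x_i may be used, and the same maximality argument for the ∂_i yields a usable
downward step, unless some weight vector is killed by every ∂_i. Such a vector has Euler weight 0,
as a constant function does. Then λ is an integer, hence a sum of weights d_i by hypothesis, and the
x_i lead from weight 0 up to λ.

For g = gcd > 1, take x^α K[x_i, x_i⁻¹] with ∑ d_i α_i = λ + 1. Its weights all lie in λ + 1 + gℤ,
so λ is missing. Saturation does not create it: monomials in the x_i shift weights by multiples of
g, so a new vector of weight λ would be torsion. -/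

/-! ### Monoids of integers generated by signed weights -/

/-- A submonoid of ℤ with generators of both signs is closed under negation, hence is a subgroup gℤ.
Here g divides every d_i, so g is a unit. The sets s and t may overlap. -/
lemma closure_union_neg_eq_top {ι : Type} [Fintype ι] (d : ι → ℕ) (hd : ∀ i, 0 < d i)
    (hgcd : Finset.univ.gcd d = 1) (s t : Set ι) (hst : s ∪ t = Set.univ) (hs : s.Nonempty)
    (ht : t.Nonempty) :
    AddSubmonoid.closure ((fun i => (d i : ℤ)) '' s) ⊔
      AddSubmonoid.closure ((fun i => -(d i : ℤ)) '' t) = ⊤ := by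
  set C := AddSubmonoid.closure ((fun i => (d i : ℤ)) '' s) ⊔
    AddSubmonoid.closure ((fun i => -(d i : ℤ)) '' t) with hC
  have hsC : ∀ i ∈ s, (d i : ℤ) ∈ C := fun i hi =>
    (le_sup_left : _ ≤ C) (AddSubmonoid.subset_closure ⟨i, hi, rfl⟩)
  have htC : ∀ i ∈ t, -(d i : ℤ) ∈ C := fun i hi =>
    (le_sup_right : _ ≤ C) (AddSubmonoid.subset_closure ⟨i, hi, rfl⟩)
  have hsC' : ∀ i ∈ s, -(d i : ℤ) ∈ C := by
    intro i hi
    obtain ⟨j, hj⟩ := ht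
    -- -d_i = (d_j - 1) d_i + d_i (-d_j); positivity of d_j makes the natural subtraction exact.
    have h := add_mem (nsmul_mem (hsC i hi) (d j - 1)) (nsmul_mem (htC j hj) (d i))
    have e : (d j - 1) • (d i : ℤ) + d i • (-(d j : ℤ)) = -(d i : ℤ) := by
      simp only [nsmul_eq_mul, Nat.cast_sub (hd j)]
      push_cast
      ring
    rwa [e] at h
  have htC' : ∀ i ∈ t, (d i : ℤ) ∈ C := by
    intro i hi
    obtain ⟨j, hj⟩ := hs
    have h := add_mem (nsmul_mem (htC i hi) (d j - 1)) (nsmul_mem (hsC j hj) (d i))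
    have e : (d j - 1) • (-(d i : ℤ)) + d i • (d j : ℤ) = (d i : ℤ) := by
      simp only [nsmul_eq_mul, Nat.cast_sub (hd j)]
      push_cast
      ring
    rwa [e] at h
  have hneg : ∀ a ∈ C, -a ∈ C := by
    have hle : C ≤ C.comap (negAddMonoidHom : ℤ →+ ℤ) := by
      refine sup_le ?_ ?_ <;> refine AddSubmonoid.closure_le.2 ?_ <;> rintro _ ⟨i, hi, rfl⟩
      · exact hsC' i hi
      · simpa using htC' i hi
    exact hle
  let H : AddSubgroup ℤ := { C with neg_mem' := fun {a} ha => hneg a ha }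
  obtain ⟨g, hg⟩ := Int.subgroup_cyclic H
  have hgd : ∀ i, g ∣ (d i : ℤ) := by
    intro i
    have : (d i : ℤ) ∈ H := by
      have hi : i ∈ s ∪ t := hst ▸ Set.mem_univ i
      exact hi.elim (hsC i) (htC' i)
    rw [hg] at this
    exact Int.mem_zmultiples_iff.1 (by rwa [AddSubgroup.zmultiples_eq_closure])
  have hg1 : g.natAbs ∣ 1 := by
    rw [← hgcd]
    exact Finset.dvd_gcd fun i _ => Int.natAbs_dvd_natAbs.2 (hgd i)
  refine eq_top_iff.2 fun z _ => ?_
  change z ∈ H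
  rw [hg, ← AddSubgroup.zmultiples_eq_closure, Int.mem_zmultiples_iff]
  exact (Int.natAbs_dvd.1 (by simpa using Int.natCast_dvd_natCast.2 hg1)).trans (one_dvd z)

/-- The walking principle: P k will say that a suitable nonzero vector of weight λ + k exists, and
each e i is the degree of an operator that preserves such vectors. -/
lemma of_mem_closure_image {ι : Type} {P : ℤ → Prop} {e : ι → ℤ} {s : Set ι}
    (h : ∀ i ∈ s, ∀ k, P k → P (k + e i)) {a : ℤ} (ha : a ∈ AddSubmonoid.closure (e '' s)) :
    ∀ k, P k → P (k + a) := by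
  induction ha using AddSubmonoid.closure_induction with
  | mem a ha => obtain ⟨i, hi, rfl⟩ := ha; exact h i hi
  | zero => simp
  | add a b _ _ ha hb => intro k hk; rw [← add_assoc]; exact hb _ (ha k hk)

/-! ### Moving weight vectors by x_i and ∂_i -/

variable {K : Type u} [Field K] {ι : Type} [Fintype ι] [DecidableEq ι]
  {M : Type u} [AddCommGroup M] [Module (Weyl K ι) M]

lemma eq_zero_of_algebraMap_smul {c : K} (hc : c ≠ 0) {m : M}
    (h : algebraMap K (Weyl K ι) c • m = 0) : m = 0 := by
  have := congrArg (algebraMap K (Weyl K ι) c⁻¹ • ·) h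
  simpa [smul_smul, ← map_mul, hc] using this

lemma x_mem_homogeneousPart (d : ι → ℕ) (i : ι) : x K i ∈ homogeneousPart K d (d i) :=
  Submodule.subset_span ⟨[Sum.inl i], by simp [genDegree], by simp [x]⟩

lemma del_mem_homogeneousPart (d : ι → ℕ) (i : ι) : del K i ∈ homogeneousPart K d (-(d i)) :=
  Submodule.subset_span ⟨[Sum.inr i], by simp [genDegree], by simp [del]⟩

lemma smul_mem_weightSpace_add (d : ι → ℕ) {lam : K} {k l : ℤ} {a : Weyl K ι} {m : M}
    (ha : a ∈ homogeneousPart K d l) (hm : m ∈ weightSpace d (lam + k) M) :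
    a • m ∈ weightSpace d (lam + (k + l : ℤ)) M := by
  have := smul_mem_weightSpace d ha hm
  rwa [add_assoc, ← Int.cast_add] at this

variable (M) in
/-- There is a nonzero element of weight `lam + k` which satisfies `Q`. -/
def HasWeightVector (d : ι → ℕ) (lam : K) (Q : M → Prop) (k : ℤ) : Prop :=
  ∃ m ∈ weightSpace d (lam + k) M, m ≠ 0 ∧ Q m

/-- For commuting homogeneous operators `y i` there is a largest set of them which annihilates a
weight vector. The other operators are injective on the weight vectors annihilated by it. -/
lemma exists_maximal_annihilated (d : ι → ℕ) (lam : K) (y : ι → Weyl K ι) (e : ι → ℤ)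
    (hy : ∀ i, y i ∈ homogeneousPart K d (e i)) (hcomm : ∀ i j, y i * y j = y j * y i)
    (h : ∃ k, HasWeightVector M d lam (fun _ => True) k) :
    ∃ S : Finset ι, (∃ k, HasWeightVector M d lam (fun m => ∀ i ∈ S, y i • m = 0) k) ∧
      ∀ j ∉ S, ∀ k, HasWeightVector M d lam (fun m => ∀ i ∈ S, y i • m = 0) k →
        HasWeightVector M d lam (fun m => ∀ i ∈ S, y i • m = 0) (k + e j) := by
  obtain ⟨S, hS⟩ := (Set.toFinite {S : Finset ι |
    ∃ k, HasWeightVector M d lam (fun m => ∀ i ∈ S, y i • m = 0) k}).exists_maximal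
    ⟨∅, by simpa using h⟩
  refine ⟨S, hS.prop, ?_⟩
  rintro j hj k ⟨m, hm, hm0, hann⟩
  -- If y j killed m, then m would witness the larger set `insert j S`, against maximality.
  refine ⟨y j • m, smul_mem_weightSpace_add d (hy j) hm, fun h0 => hj ?_, fun i hi => ?_⟩
  · refine hS.le_of_ge (y := insert j S) ⟨k, m, hm, hm0, ?_⟩ (Finset.subset_insert _ _)
      (Finset.mem_insert_self _ _)
    intro i hi
    rcases Finset.mem_insert.1 hi with rfl | hi
    exacts [h0, hann i hi]
  · rw [smul_smul, hcomm, mul_smul, hann i hi, smul_zero]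

/-- By [∂_i, x_i] = 1. This is the delta function itself, the case c = 0 of `IsDeltaIn`. -/
lemma x_del_smul_of_x_smul_eq_zero {i : ι} {m : M} (h : x K i • m = 0) :
    (x K i * del K i) • m = -m := by
  have := del_mul_x K i i
  rw [if_pos rfl] at this
  rw [eq_sub_of_add_eq this.symm, sub_smul, mul_smul, h, smul_zero, one_smul, zero_sub]

lemma x_del_mul_del (i j : ι) : x K i * del K i * del K j =
    del K j * (x K i * del K i) - if i = j then del K j else 0 := by
  have h := del_mul_x K j i
  rw [mul_assoc, del_mul_del, ← mul_assoc, eq_sub_of_add_eq h.symm, sub_mul, mul_assoc]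
  by_cases hij : i = j
  · subst hij; simp
  · simp [hij, Ne.symm hij]

variable (K) in
/-- Weight vectors which, in each variable of `S`, behave like derivatives of a delta function. -/
def IsDeltaIn (S : Finset ι) (m : M) : Prop :=
  ∀ i ∈ S, ∃ c : ℕ, (x K i * del K i) • m = algebraMap K (Weyl K ι) (-((c + 1 : ℕ) : K)) • m

/-- The eigenvalue -(c + 1) of x_j ∂_j is nonzero in characteristic zero, so ∂_j m ≠ 0. Applying ∂_j
lowers it to -(c + 2) and leaves the other eigenvalues alone, so the step can be repeated. -/
lemma hasWeightVector_isDeltaIn_del [CharZero K] (d : ι → ℕ) (lam : K) (S : Finset ι) {j : ι}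
    (hj : j ∈ S) (k : ℤ) (h : HasWeightVector M d lam (IsDeltaIn K S) k) :
    HasWeightVector M d lam (IsDeltaIn K S) (k + -(d j : ℤ)) := by
  obtain ⟨m, hm, hm0, hS⟩ := h
  refine ⟨del K j • m, smul_mem_weightSpace_add d (del_mem_homogeneousPart d j) hm, ?_, ?_⟩
  · intro h0
    obtain ⟨c, hc⟩ := hS j hj
    rw [mul_smul, h0, smul_zero] at hc
    exact hm0 (eq_zero_of_algebraMap_smul (neg_ne_zero.2 (Nat.cast_ne_zero.2 c.succ_ne_zero))
      hc.symm)
  · intro i hi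
    obtain ⟨c, hc⟩ := hS i hi
    rw [smul_smul, x_del_mul_del, sub_smul, mul_smul, hc, smul_smul, ← Algebra.commutes, mul_smul]
    split_ifs
    · refine ⟨c + 1, ?_⟩
      push_cast
      simp only [neg_add, add_smul, neg_smul, one_smul]
      abel
    · exact ⟨c, by simp⟩

/-- A weight vector annihilated by every `∂ᵢ` has weight zero. -/
lemma eq_zero_of_del_smul_eq_zero (d : ι → ℕ) {μ : K} {m : M} (hm : m ∈ weightSpace d μ M)
    (hm0 : m ≠ 0)
    (h : ∀ i : ι, del K i • m = 0) : μ = 0 := by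
  by_contra hμ
  refine hm0 (eq_zero_of_algebraMap_smul (ι := ι) hμ ?_)
  change euler K d • m = _ at hm
  rw [← hm, euler, Finset.sum_smul]
  exact Finset.sum_eq_zero fun i _ => by rw [mul_smul, mul_smul, h i, smul_zero, smul_zero]

/-- If `gcd d = 1` and `lam` is not an integer or is in the semigroup generated by the weights,
a nonzero `lam`-Euler module without torsion has a nonzero element of weight `lam`. -/
theorem exists_weightSpace_ne_zero [CharZero K] [Nonempty ι] (d : ι → ℕ) (hd : ∀ i, 0 < d i)
    (hgcd : Finset.univ.gcd d = 1) (lam : K)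
    (hlam : lam ∈ (Set.range (Int.cast : ℤ → K))ᶜ ∪
      (Nat.cast : ℕ → K) '' (AddSubmonoid.closure (Set.range d) : Set ℕ))
    (hfree : ∀ (k : ℤ), ∀ m ∈ weightSpace d (lam + k) M, m ∈ torsionSubmodule K ι M → m = 0)
    (h : ∃ k, HasWeightVector M d lam (fun _ => True) k) :
    HasWeightVector M d lam (fun _ => True) 0 := by
  obtain ⟨S, ⟨k, hk⟩, hS⟩ := exists_maximal_annihilated d lam (x K) (fun i => (d i : ℤ))
    (x_mem_homogeneousPart d) (x_mul_x K) h
  -- A vector killed by every x_i satisfies J m = 0 and is torsion.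
  have hSuniv : ∃ j, j ∉ S := by
    by_contra! hall
    obtain ⟨m, hm, hm0, hann⟩ := hk
    refine hm0 (hfree k m hm ⟨1, fun w hw => ?_⟩)
    obtain ⟨i, rfl⟩ := List.length_eq_one_iff.1 hw
    simpa [monomialX] using hann i (hall i)
  rcases S.eq_empty_or_nonempty with rfl | hne
  · simp only [Finset.notMem_empty, false_imp_iff, implies_true, not_false_eq_true,
      forall_const] at hS
    obtain ⟨T, ⟨l, hl⟩, hT⟩ := exists_maximal_annihilated d lam (del K) (fun i => -(d i : ℤ))
      (del_mem_homogeneousPart d) (del_mul_del K) h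
    by_cases hTuniv : ∃ j, j ∉ T
    · obtain ⟨j, hj⟩ := hTuniv
      have htop := closure_union_neg_eq_top d hd hgcd Set.univ {j} (by simp) Set.univ_nonempty
        (Set.singleton_nonempty j)
      obtain ⟨a, ha, b, hb, hab⟩ := AddSubmonoid.mem_sup.1 (htop ▸ AddSubmonoid.mem_top (-l))
      -- The ∂_j steps come first: they need annihilation by the ∂_i with i in T, which the x_i do
      -- not preserve. The x_i act injectively on all weight vectors and can follow.
      obtain ⟨m, hm, hm0, -⟩ := of_mem_closure_image
        (fun i hi => by rw [Set.mem_singleton_iff.1 hi]; exact hT j hj) hb l hl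
      have := of_mem_closure_image (fun i _ => hS i) ha _ ⟨m, hm, hm0, trivial⟩
      rwa [show l + b + a = 0 by omega] at this
    · push Not at hTuniv
      obtain ⟨m, hm, hm0, hann⟩ := hl
      have hl0 := eq_zero_of_del_smul_eq_zero d hm hm0 fun i => hann i (hTuniv i)
      have hlam' : lam = ((-l : ℤ) : K) := by
        rw [Int.cast_neg]; exact eq_neg_of_add_eq_zero_left hl0
      rcases hlam with hlam | ⟨a, ha, rfl⟩
      · exact absurd ⟨-l, hlam'.symm⟩ hlam
      -- Characteristic zero brings the equality in K down to ℤ: the distance from l up to 0 is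
      -- exactly the element a of the semigroup.
      · have hal : (a : ℤ) = -l := by exact_mod_cast hlam'
        have ha' : (a : ℤ) ∈ AddSubmonoid.closure ((fun i => (d i : ℤ)) '' Set.univ) := by
          have := AddSubmonoid.mem_map_of_mem (Nat.castAddMonoidHom ℤ) ha
          rw [AddMonoidHom.map_mclosure, ← Set.range_comp] at this
          rw [Set.image_univ]
          exact this
        have := of_mem_closure_image (fun i _ => hS i) ha' l ⟨m, hm, hm0, trivial⟩
        rwa [hal, add_neg_cancel] at this
  · have htop := closure_union_neg_eq_top d hd hgcd (S : Set ι)ᶜ S (Set.compl_union_self _)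
      hSuniv hne
    obtain ⟨a, ha, b, hb, hab⟩ := AddSubmonoid.mem_sup.1 (htop ▸ AddSubmonoid.mem_top (-k))
    -- Here the x_j steps come first: they need annihilation by the x_i with i in S, and after a ∂_i
    -- only the weaker delta property remains.
    obtain ⟨m, hm, hm0, hann⟩ := of_mem_closure_image hS ha k hk
    have hdelta : HasWeightVector M d lam (IsDeltaIn K S) (k + a) :=
      ⟨m, hm, hm0, fun i hi =>
        ⟨0, by rw [x_del_smul_of_x_smul_eq_zero (hann i hi)]; simp⟩⟩
    obtain ⟨m', hm', hm0', -⟩ := of_mem_closure_image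
      (fun i hi => hasWeightVector_isDeltaIn_del d lam S hi) hb _ hdelta
    rw [show k + a + b = 0 by omega] at hm'
    exact ⟨m', hm', hm0', trivial⟩

/-! ### Saturated modules and the kernel of Γ_λ -/

/-- Twisted D-modules are equivalent to saturated modules, and the section functor is the inverse
equivalence followed by the inclusion. -/
lemma exists_equivalence_isLocal (d : ι → ℕ) (lam : K) :
    ∃ e : (torsionIso d lam).isLocal.FullSubcategory ≌ TwistedDMod d lam,
      Nonempty (sectionFunctor d lam ≅ e.inverse ⋙ (torsionIso d lam).isLocal.ι) := by
  have := isRightAdjoint_ι d lam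
  let F := (torsionIso d lam).isLocal.ι
  let adj := Adjunction.ofIsRightAdjoint F
  -- The morphisms that every saturated module sees as isomorphisms are exactly those with torsion
  -- kernel and cokernel, so the reflection onto saturated modules is also a localization at
  -- `torsionIso`.
  have hW : torsionIso d lam = ObjectProperty.isLocal (· ∈ Set.range F.obj) := by
    have hr : (· ∈ Set.range F.obj : ObjectProperty (EulerMod d lam)) =
        (torsionIso d lam).isLocal := by
      ext X
      exact ⟨fun ⟨Y, hY⟩ => hY ▸ Y.property, fun h => ⟨⟨X, h⟩, rfl⟩⟩
    rw [hr]
    exact le_antisymm (MorphismProperty.le_isLocal_isLocal _)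
      fun _ _ f hf => torsionIso_of_isLocal d lam f hf
  have hloc : ∀ W, W = ObjectProperty.isLocal (· ∈ Set.range F.obj) →
      F.leftAdjoint.IsLocalization W := by
    rintro _ rfl
    exact ObjectProperty.isLocalization_isLocal adj
  have := hloc _ hW
  let e := Localization.compUniqFunctor F.leftAdjoint (quotientFunctor d lam) (torsionIso d lam)
  let u := Localization.uniq F.leftAdjoint (quotientFunctor d lam) (torsionIso d lam)
  -- Both functors are right adjoint to the quotient functor.
  exact ⟨u, ⟨(sectionAdjunction d lam).rightAdjointUniq
    ((adj.comp u.toAdjunction).ofNatIsoLeft e)⟩⟩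

lemma isEuler_of_subsingleton (d : ι → ℕ) (lam : K) (M : Type u) [AddCommGroup M]
    [Module (Weyl K ι) M] [Subsingleton M] : IsEuler d lam M :=
  Subsingleton.elim _ _

/-- Saturated modules have no torsion weight vectors. -/
lemma eq_zero_of_mem_torsionSubmodule {d : ι → ℕ} {lam : K} {S : EulerMod d lam}
    (hS : (torsionIso d lam).isLocal S) {k : ℤ} {m : S.obj}
    (hm : m ∈ weightSpace d (lam + k) S.obj) (hmt : m ∈ torsionSubmodule K ι S.obj) : m = 0 := by
  let T := eulerPart d lam (torsionSubmodule K ι S.obj)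
  let N : EulerMod d lam := ⟨ModuleCat.of _ T, isEuler_eulerPart d lam _⟩
  let Z : EulerMod d lam := ⟨ModuleCat.of _ PUnit.{u + 1}, isEuler_of_subsingleton d lam PUnit⟩
  let f : N ⟶ Z := ObjectProperty.homMk (ModuleCat.ofHom (0 : T →ₗ[Weyl K ι] PUnit.{u + 1}))
  have hf : torsionIso d lam f := by
    refine ⟨?_, ?_⟩
    · rw [isTorsion_ker_iff]
      intro t _
      exact mem_torsionModulo_of_map T.subtype (L' := ⊥) (by simp) (eulerPart_le d lam _ t.2)
    · rw [isTorsion_quotient_iff]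
      exact eq_top_iff.2 fun z _ => le_torsionModulo _ ⟨0, Subsingleton.elim (α := PUnit.{u + 1}) _ _⟩
  -- The map from the Euler part T of the torsion to 0 is inverted in the quotient, so the inclusion
  -- of T factors through 0.
  obtain ⟨g, hg⟩ := (hS f hf).2 (ObjectProperty.homMk (ModuleCat.ofHom T.subtype))
  have hmT : m ∈ T := AddSubgroup.subset_closure ⟨hmt, k, hm⟩
  have h1 : EulerMod.lin g (0 : PUnit.{u + 1}) = m :=
    LinearMap.congr_fun (congrArg EulerMod.lin hg) (⟨m, hmT⟩ : T)
  rw [← h1]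
  exact map_zero (EulerMod.lin g)

lemma isZero_of_subsingleton {d : ι → ℕ} {lam : K} (M : EulerMod d lam) [Subsingleton M.obj] :
    Limits.IsZero M := by
  rw [Limits.IsZero.iff_id_eq_zero]
  apply ObjectProperty.hom_ext
  apply ModuleCat.hom_ext
  exact LinearMap.ext fun m => Subsingleton.elim (α := M.obj) _ _

lemma subsingleton_of_isZero {d : ι → ℕ} {lam : K} {M : EulerMod d lam}
    (h : Limits.IsZero M) : Subsingleton M.obj := by
  have h1 := (Limits.IsZero.iff_id_eq_zero _).1 h
  exact subsingleton_of_forall_eq 0 fun m => LinearMap.congr_fun (congrArg EulerMod.lin h1) m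

/-- A nonzero Euler module has a weight vector. -/
lemma exists_hasWeightVector {d : ι → ℕ} {lam : K} {M : Type u} [AddCommGroup M]
    [Module (Weyl K ι) M] [Nontrivial M] (hM : IsEuler d lam M) :
    ∃ k, HasWeightVector M d lam (fun _ => True) k := by
  by_contra! h
  have hbot : ∀ k : ℤ, weightSpace d (lam + k) M = ⊥ := by
    refine fun k => (AddSubgroup.eq_bot_iff_forall _).2 fun m hm => ?_
    by_contra hm0
    exact h k ⟨m, hm, hm0, trivial⟩
  rw [IsEuler, iSup_congr hbot, iSup_bot] at hM
  exact bot_ne_top hM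

lemma isZero_of_isZero_obj {C D : Type*} [Category* C] [Category* D] (F : C ⥤ D) [F.Full]
    [F.Faithful] {X : C} (h : Limits.IsZero (F.obj X)) : Limits.IsZero X :=
  ⟨fun Y => ⟨⟨⟨F.preimage (h.to_ (F.obj Y))⟩, fun _ => F.map_injective (h.eq_of_src _ _)⟩⟩,
    fun Y => ⟨⟨⟨F.preimage (h.from_ (F.obj Y))⟩, fun _ => F.map_injective (h.eq_of_tgt _ _)⟩⟩⟩

/-- Under an equivalence as above, `Γ_λ(ℳ) = 0` says that the saturated module of `ℳ` has no
nonzero element of weight `lam`. -/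
lemma kernelGlobalSections_iff {d : ι → ℕ} {lam : K}
    {e : (torsionIso d lam).isLocal.FullSubcategory ≌ TwistedDMod d lam}
    (i : sectionFunctor d lam ≅ e.inverse ⋙ (torsionIso d lam).isLocal.ι)
    (ℳ : TwistedDMod d lam) :
    kernelGlobalSections d lam ℳ ↔ weightSpace d lam (e.inverse.obj ℳ).obj.obj = ⊥ := by
  have h : (globalSections d lam).obj ℳ ≅
      (degreeZeroFunctor d lam).obj (e.inverse.obj ℳ).obj :=
    (degreeZeroFunctor d lam).mapIso (i.app ℳ)
  rw [kernelGlobalSections, h.isZero_iff, ModuleCat.isZero_iff_subsingleton,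
    AddSubgroup.eq_bot_iff_forall]
  constructor
  · intro h m hm
    exact congrArg Subtype.val (h.elim (⟨m, hm⟩ : weightSpace d lam _) 0)
  · exact fun h => subsingleton_of_forall_eq 0 fun m => Subtype.ext (h m.1 m.2)

/-- If `gcd d = 1` and `lam` is not an integer or is in the semigroup generated by the weights,
then every twisted D-module without global sections is zero. -/
theorem isZero_of_kernelGlobalSections [CharZero K] [Nonempty ι] (d : ι → ℕ) (hd : ∀ i, 0 < d i)
    (hgcd : Finset.univ.gcd d = 1) (lam : K)
    (hlam : lam ∈ (Set.range (Int.cast : ℤ → K))ᶜ ∪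
      (Nat.cast : ℕ → K) '' (AddSubmonoid.closure (Set.range d) : Set ℕ))
    (ℳ : TwistedDMod d lam) (h : kernelGlobalSections d lam ℳ) : Limits.IsZero ℳ := by
  obtain ⟨e, ⟨i⟩⟩ := exists_equivalence_isLocal d lam
  rw [kernelGlobalSections_iff i] at h
  set S := e.inverse.obj ℳ
  have hS : Subsingleton S.obj.obj := by
    by_contra hne
    rw [not_subsingleton_iff_nontrivial] at hne
    obtain ⟨m, hm, hm0, -⟩ := exists_weightSpace_ne_zero d hd hgcd lam hlam
      (fun k m hm => eq_zero_of_mem_torsionSubmodule S.property hm)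
      (exists_hasWeightVector S.obj.property)
    rw [Int.cast_zero, add_zero, h] at hm
    exact hm0 hm
  exact isZero_of_isZero_obj (e.inverse ⋙ (torsionIso d lam).isLocal.ι)
    (isZero_of_subsingleton S.obj)

/-! ### Twisted Laurent polynomials -/

/-- The space with basis the monomials `x^(α + b)`, `b ∈ ℤ^ι`. -/
def TwistedLaurent (_α : ι → K) : Type u := (ι → ℤ) →₀ K

namespace TwistedLaurent

variable (α : ι → K)

noncomputable instance : AddCommGroup (TwistedLaurent α) :=
  inferInstanceAs (AddCommGroup ((ι → ℤ) →₀ K))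

/-- Multiplication by `xᵢ`, or the derivative `∂ᵢ`. -/
noncomputable def genAction : ι ⊕ ι → Module.End K ((ι → ℤ) →₀ K)
  | Sum.inl i => Finsupp.lmapDomain K K (· + Pi.single i 1)
  | Sum.inr i => Finsupp.linearCombination K
      (fun b => Finsupp.single (b - Pi.single i 1) (α i + b i))

lemma genAction_inl_single (i : ι) (b : ι → ℤ) (c : K) :
    genAction α (Sum.inl i) (Finsupp.single b c) = Finsupp.single (b + Pi.single i 1) c :=
  Finsupp.mapDomain_single

lemma genAction_inr_single (i : ι) (b : ι → ℤ) (c : K) :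
    genAction α (Sum.inr i) (Finsupp.single b c) =
      Finsupp.single (b - Pi.single i 1) (c * (α i + b i)) := by
  rw [genAction, Finsupp.linearCombination_single, Finsupp.smul_single, smul_eq_mul]

/-- The action of the Weyl algebra on twisted Laurent polynomials. -/
noncomputable def action : Weyl K ι →ₐ[K] Module.End K ((ι → ℤ) →₀ K) :=
  RingQuot.liftAlgHom K ⟨FreeAlgebra.lift K (genAction α), by
    intro a b hab
    induction hab with
    | x_x i j =>
      refine Finsupp.lhom_ext fun b c => ?_
      simp only [map_mul, FreeAlgebra.lift_ι_apply, Module.End.mul_apply, genAction_inl_single,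
        add_right_comm]
    | del_del i j =>
      refine Finsupp.lhom_ext fun b c => ?_
      by_cases hij : i = j
      · rw [hij]
      · simp only [map_mul, FreeAlgebra.lift_ι_apply, Module.End.mul_apply, genAction_inr_single,
          Pi.sub_apply, Pi.single_eq_of_ne hij, Pi.single_eq_of_ne (Ne.symm hij), sub_zero,
          sub_right_comm b, mul_right_comm c]
    | del_x i j =>
      refine Finsupp.lhom_ext fun b c => ?_
      by_cases hij : i = j
      · subst hij
        simp only [map_mul, map_add, if_true, map_one, FreeAlgebra.lift_ι_apply,
          Module.End.mul_apply, LinearMap.add_apply, Module.End.one_apply, genAction_inr_single,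
          genAction_inl_single, Pi.add_apply, Pi.single_eq_same, add_sub_cancel_right,
          sub_add_cancel, ← Finsupp.single_add]
        congr 1
        push_cast
        ring
      · simp only [map_mul, if_neg hij, add_zero, FreeAlgebra.lift_ι_apply,
          Module.End.mul_apply, genAction_inr_single, genAction_inl_single, Pi.add_apply,
          Pi.single_eq_of_ne hij, sub_add_eq_add_sub]⟩

lemma action_gen (s : ι ⊕ ι) : action α (gen K s) = genAction α s :=
  (RingQuot.liftAlgHom_mkAlgHom_apply _ _ _ _).trans (FreeAlgebra.lift_ι_apply _ _)

noncomputable instance : Module (Weyl K ι) (TwistedLaurent α) :=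
  Module.compHom ((ι → ℤ) →₀ K) (action α).toRingHom

/-- The element `c x^(α + b)`. -/
noncomputable def monomial (b : ι → ℤ) : K →+ TwistedLaurent α := Finsupp.singleAddHom b

/-- The coefficient of `x^(α + b)`. -/
noncomputable def coeff (b : ι → ℤ) : TwistedLaurent α →+ K := Finsupp.applyAddHom b

variable {α}

lemma hom_ext_coeff {m m' : TwistedLaurent α} (h : ∀ b, coeff α b m = coeff α b m') : m = m' :=
  Finsupp.ext h

@[elab_as_elim]
lemma induction {P : TwistedLaurent α → Prop} (h0 : P 0) (hadd : ∀ m m', P m → P m' → P (m + m'))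
    (hmono : ∀ b c, P (monomial α b c)) (m : TwistedLaurent α) : P m :=
  Finsupp.induction_linear m h0 hadd hmono

lemma coeff_monomial (a b : ι → ℤ) (c : K) :
    coeff α b (monomial α a c) = if a = b then c else 0 :=
  Finsupp.single_apply

lemma x_smul_monomial (i : ι) (b : ι → ℤ) (c : K) :
    x K i • monomial α b c = monomial α (b + Pi.single i 1) c :=
  (LinearMap.congr_fun (action_gen α _) _).trans (genAction_inl_single α i b c)

lemma del_smul_monomial (i : ι) (b : ι → ℤ) (c : K) :
    del K i • monomial α b c = monomial α (b - Pi.single i 1) (c * (α i + b i)) :=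
  (LinearMap.congr_fun (action_gen α _) _).trans (genAction_inr_single α i b c)

lemma algebraMap_smul_monomial (r : K) (b : ι → ℤ) (c : K) :
    algebraMap K (Weyl K ι) r • monomial α b c = monomial α b (r * c) :=
  (LinearMap.congr_fun ((action α).commutes r) _).trans (Finsupp.smul_single r b c)

lemma coeff_algebraMap_smul (r : K) (m : TwistedLaurent α) (b : ι → ℤ) :
    coeff α b (algebraMap K (Weyl K ι) r • m) = r * coeff α b m := by
  induction m using induction with
  | h0 => simp
  | hadd m m' h h' => rw [smul_add, map_add, h, h', map_add, mul_add]
  | hmono a c =>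
    rw [algebraMap_smul_monomial, coeff_monomial, coeff_monomial]
    split_ifs <;> simp

lemma coeff_x_smul (i : ι) (m : TwistedLaurent α) (b : ι → ℤ) :
    coeff α (b + Pi.single i 1) (x K i • m) = coeff α b m := by
  induction m using induction with
  | h0 => simp
  | hadd m m' h h' => rw [smul_add, map_add, h, h', map_add]
  | hmono a c => rw [x_smul_monomial, coeff_monomial, coeff_monomial]; simp

lemma eq_zero_of_x_smul_eq_zero {i : ι} {m : TwistedLaurent α} (h : x K i • m = 0) : m = 0 :=
  hom_ext_coeff fun b => by rw [← coeff_x_smul i, h, map_zero, map_zero]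

lemma euler_smul_monomial (d : ι → ℕ) (b : ι → ℤ) (c : K) :
    euler K d • monomial α b c = monomial α b ((∑ i, d i * (α i + b i)) * c) := by
  have h : ∀ i, ((d i : Weyl K ι) * (x K i * del K i)) • monomial α b c =
      monomial α b (d i * (α i + b i) * c) := by
    intro i
    rw [← map_natCast (algebraMap K (Weyl K ι)), mul_smul, mul_smul, del_smul_monomial,
      x_smul_monomial, algebraMap_smul_monomial, sub_add_cancel]
    congr 1
    ring
  rw [euler, Finset.sum_smul, Finset.sum_congr rfl fun i _ => h i, Finset.sum_mul, map_sum]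

lemma coeff_euler_smul (d : ι → ℕ) (m : TwistedLaurent α) (b : ι → ℤ) :
    coeff α b (euler K d • m) = (∑ i, d i * (α i + b i)) * coeff α b m := by
  induction m using induction with
  | h0 => simp
  | hadd m m' h h' => rw [smul_add, map_add, h, h', map_add, mul_add]
  | hmono a c =>
    rw [euler_smul_monomial, coeff_monomial, coeff_monomial]
    split_ifs with h
    · rw [h]
    · simp

lemma isEuler (d : ι → ℕ) (lam : K) {l : ℤ} (hα : ∑ i, d i * α i = lam + l) :
    IsEuler d lam (TwistedLaurent α) := by
  refine eq_top_iff.2 fun m _ => ?_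
  induction m using induction with
  | h0 => exact zero_mem _
  | hadd m m' h h' => exact add_mem (h trivial) (h' trivial)
  | hmono b c =>
    refine AddSubgroup.mem_iSup_of_mem (l + ∑ i, d i * b i) ?_
    change euler K d • _ = _
    rw [euler_smul_monomial, algebraMap_smul_monomial]
    simp only [mul_add, Finset.sum_add_distrib, hα]
    push_cast
    rw [add_assoc]

/-- The monomial x^(α + b) has weight λ + l + ∑ d_i b_i, and l + ∑ d_i b_i is congruent to l modulo
g, hence never divisible by g. -/
lemma eq_zero_of_mem_weightSpace [CharZero K] (d : ι → ℕ) (lam : K) {l : ℤ}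
    (hα : ∑ i, d i * α i = lam + l) {g : ℤ} (hg : ∀ i, g ∣ d i) (hl : ¬ g ∣ l) {k : ℤ}
    (hk : g ∣ k) {m : TwistedLaurent α} (hm : m ∈ weightSpace d (lam + k) (TwistedLaurent α)) :
    m = 0 := by
  change euler K d • m = _ at hm
  refine hom_ext_coeff fun b => ?_
  have h := coeff_euler_smul d m b
  rw [hm, coeff_algebraMap_smul, eq_comm] at h
  rw [map_zero]
  by_contra hb
  have h' := mul_right_cancel₀ hb h
  simp only [mul_add, Finset.sum_add_distrib, hα] at h'
  rw [add_assoc, add_left_cancel_iff] at h'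
  have h'' : l + ∑ i, d i * b i = k := by exact_mod_cast h'
  refine hl ?_
  rw [← eq_sub_iff_add_eq] at h''
  rw [h'']
  exact dvd_sub hk (Finset.dvd_sum fun i _ => (hg i).mul_right _)

/-- Each x_i merely shifts the basis and so acts injectively; a power of a single x_i already
detects torsion. -/
lemma eq_zero_of_mem_torsionSubmodule [Nonempty ι] {m : TwistedLaurent α}
    (hm : m ∈ torsionSubmodule K ι (TwistedLaurent α)) : m = 0 := by
  obtain ⟨k, hk⟩ := hm
  let i : ι := Classical.arbitrary ι
  induction k with
  | zero => simpa [monomialX_nil] using hk [] rfl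
  | succ k ih =>
    have h : ∀ (w : List ι), monomialX K w • m = 0 → m = 0 := by
      intro w
      induction w with
      | nil => simp [monomialX_nil]
      | cons j w ih =>
        rw [monomialX_cons, mul_smul]
        exact fun h => ih (eq_zero_of_x_smul_eq_zero h)
    exact h (List.replicate (k + 1) i) (hk _ (by simp))

variable (α) in
instance : Nontrivial (TwistedLaurent α) :=
  inferInstanceAs (Nontrivial ((ι → ℤ) →₀ K))

end TwistedLaurent

/-! ### A nonzero object without global sections when the gcd exceeds 1 -/

lemma monomialX_mem_homogeneousPart (d : ι → ℕ) (w : List ι) :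
    monomialX K w ∈ homogeneousPart K d (w.map (fun i => (d i : ℤ))).sum := by
  refine Submodule.subset_span ⟨w.map Sum.inl, ?_, ?_⟩ <;> rw [List.map_map] <;> rfl

/-- If `gcd d ≠ 1` there are nonzero twisted D-modules without global sections. -/
theorem exists_kernelGlobalSections_not_isZero [CharZero K] [Nonempty ι] (d : ι → ℕ)
    (hd : ∀ i, 0 < d i) (hgcd : 1 < Finset.univ.gcd d) (lam : K) :
    ∃ ℳ : TwistedDMod d lam, kernelGlobalSections d lam ℳ ∧ ¬ Limits.IsZero ℳ := by
  obtain ⟨j⟩ := ‹Nonempty ι›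
  have hj : (d j : K) ≠ 0 := Nat.cast_ne_zero.2 (hd j).ne'
  -- Chosen so that the weights are offset from λ by 1, which is not divisible by the gcd.
  let α : ι → K := Pi.single j ((lam + 1) / d j)
  have hα : ∑ i, d i * α i = lam + (1 : ℤ) := by
    rw [Finset.sum_eq_single j (fun i _ hi => by simp [α, hi]) (by simp)]
    simp [α, mul_div_cancel₀ _ hj]
  obtain ⟨S, f, ⟨hker, hcoker⟩, hS⟩ := exists_saturation_hom d lam
    ⟨ModuleCat.of _ (TwistedLaurent α), TwistedLaurent.isEuler d lam hα⟩
  rw [isTorsion_ker_iff] at hker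
  rw [isTorsion_quotient_iff] at hcoker
  let g : TwistedLaurent α →ₗ[Weyl K ι] S.obj := EulerMod.lin f
  have hg : ∀ m, g m = 0 → m = 0 := fun m hm =>
    TwistedLaurent.eq_zero_of_mem_torsionSubmodule (hker m hm)
  have hg' : Function.Injective g := (injective_iff_map_eq_zero g).2 hg
  have hweight : weightSpace d lam S.obj = ⊥ := by
    refine (AddSubgroup.eq_bot_iff_forall _).2 fun s hs => ?_
    -- It suffices that s is torsion. Modulo torsion s comes from the Laurent module: all monomials
    -- of some length k carry s into the image of g, at weights λ plus multiples of the gcd, where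
    -- the Laurent module vanishes.
    refine eq_zero_of_mem_torsionSubmodule hS (k := 0) (by simpa using hs) ?_
    obtain ⟨k, hk⟩ := hcoker ▸ Submodule.mem_top (x := s)
    refine ⟨k, fun w hw => ?_⟩
    obtain ⟨m, hm⟩ := hk w hw
    change g m = _ at hm
    have hws := smul_mem_weightSpace d (monomialX_mem_homogeneousPart d w) hs
    rw [← hm] at hws
    -- Injectivity of g lets the weight of g m be read off on m.
    have hmw : m ∈ weightSpace d (lam + ((w.map fun i => (d i : ℤ)).sum : ℤ))
        (TwistedLaurent α) := by
      refine hg' ?_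
      rw [map_smul, map_smul]
      exact hws
    have hm0 := TwistedLaurent.eq_zero_of_mem_weightSpace d lam hα
      (g := (Finset.univ.gcd d : ℕ))
      (fun i => Int.natCast_dvd_natCast.2 (Finset.gcd_dvd (Finset.mem_univ i)))
      (fun h => by
        have := Nat.dvd_one.1 (Int.natCast_dvd_natCast.1 (by simpa using h))
        omega)
      (List.dvd_sum (by
        rintro _ hx
        obtain ⟨i, -, rfl⟩ := List.mem_map.1 hx
        exact Int.natCast_dvd_natCast.2 (Finset.gcd_dvd (Finset.mem_univ i)))) hmw
    rw [← hm, hm0, map_zero]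
    exact zero_mem _
  obtain ⟨e, ⟨i⟩⟩ := exists_equivalence_isLocal d lam
  let T : (torsionIso d lam).isLocal.FullSubcategory := ⟨S, hS⟩
  have hTS : e.inverse.obj (e.functor.obj T) ≅ T := (e.unitIso.app T).symm
  let iso : (e.inverse.obj (e.functor.obj T)).obj ≅ S :=
    (torsionIso d lam).isLocal.ι.mapIso hTS
  refine ⟨e.functor.obj T, ?_, fun h0 => ?_⟩
  · rw [kernelGlobalSections_iff i, AddSubgroup.eq_bot_iff_forall]
    intro m hm
    have h1 := map_mem_weightSpace d (EulerMod.lin iso.hom) hm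
    rw [hweight, AddSubgroup.mem_bot] at h1
    have h2 := LinearMap.congr_fun (congrArg EulerMod.lin iso.hom_inv_id) m
    refine h2.symm.trans ?_
    change EulerMod.lin iso.inv (EulerMod.lin iso.hom m) = 0
    rw [h1, map_zero]
  · have hT0 := isZero_of_isZero_obj e.functor h0
    -- The Laurent module is nontrivial and embeds into S, so S cannot be zero.
    have : Subsingleton S.obj := subsingleton_of_isZero ((torsionIso d lam).isLocal.ι.map_isZero hT0)
    exact not_subsingleton _ hg'.subsingleton

end WeightedDMod

theorem mainTheorem3 {K : Type u} [Field K] [CharZero K] (n : ℕ) (hn : 1 ≤ n)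
    (d : Fin (n + 1) → ℕ) (hd : ∀ i, 0 < d i) :
    (Finset.univ.gcd d = 1 →
      ∀ lam : K,
        lam ∈ (Set.range (Int.cast : ℤ → K))ᶜ ∪
          (Nat.cast : ℕ → K) '' (AddSubmonoid.closure (Set.range d) : Set ℕ) →
        ∀ ℳ : WeightedDMod.TwistedDMod d lam,
          WeightedDMod.kernelGlobalSections d lam ℳ → Limits.IsZero ℳ) ∧
    (1 < Finset.univ.gcd d →
      ∀ lam : K, ∃ ℳ : WeightedDMod.TwistedDMod d lam,
        WeightedDMod.kernelGlobalSections d lam ℳ ∧ ¬ Limits.IsZero ℳ) :=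
  ⟨fun hgcd lam hlam => WeightedDMod.isZero_of_kernelGlobalSections d hd hgcd lam hlam,
    fun hgcd => WeightedDMod.exists_kernelGlobalSections_not_isZero d hd hgcd⟩
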